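/- There is an absolute constant $c>0$ such that the following holds. Let $G=(V,E)$ be a finite simple undirected graph of treewidth at most $r-1$, where $r\ge 1$ is an integer, let $T\subseteq V$ be a set of at least two vertices (the terminals), and let $k\ge 0$ be an integer. Suppose that $\kappa'_G(T)\ge k$. Here $\kappa'_G(T)=\min_{u,v\in T,\ u\ne v}\kappa'_G(u,v)$, where $\kappa'_G(u,v)$ is the maximum number of $u$-$v$ paths in $G$ no two of which have an edge or a vertex of $V\setminus T$ in common (they may share terminals). Then $G$ contains at least $$c\cdot\frac{k}{12\,r^2\log(3r)}$$ pairwise element-disjoint Steiner trees on $T$, that is, subgraphs of $G$ each of which is a tree containing all vertices of $T$, no two of which have an edge or a vertex of $V\setminus T$ in common. -/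

import Mathlib

namespace ElementPacking

universe u

/-- A tree decomposition of the graph `G`, indexed by the nodes of a finite tree. -/
structure TreeDecomposition {V : Type u} (G : SimpleGraph V) where
  /-- the nodes of the decomposition tree -/
  Node : Type
  finite_node : Finite Node
  /-- the decomposition tree -/
  tree : SimpleGraph Node
  isTree : tree.IsTree
  /-- the vertices of `G` attached to a node -/
  bag : Node → Set V
  exists_mem_bag : ∀ v : V, ∃ t : Node, v ∈ bag t
  exists_adj_mem_bag : ∀ v w : V, G.Adj v w → ∃ t : Node, v ∈ bag t ∧ w ∈ bag t
  preconnected_nodes : ∀ v : V, (tree.induce {t : Node | v ∈ bag t}).Preconnected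

/-- The width of a tree decomposition: the largest size of a bag, minus one. -/
noncomputable def TreeDecomposition.width {V : Type u} {G : SimpleGraph V}
    (D : TreeDecomposition G) : ℕ∞ :=
  (⨆ t : D.Node, (D.bag t).encard) - 1

/-- The treewidth of `G`: the least width of a tree decomposition of `G`. -/
noncomputable def treewidth {V : Type u} (G : SimpleGraph V) : ℕ∞ :=
  ⨅ D : TreeDecomposition G, D.width

/-- With respect to the set `T` of terminals, two walks are element-disjoint if they have
no edge and no non-terminal vertex in common. -/
def WalksElementDisjoint {V : Type u} {G : SimpleGraph V} (T : Set V) {u v : V}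
    (p q : G.Walk u v) : Prop :=
  (∀ e, e ∈ p.edges → e ∉ q.edges) ∧ (∀ x, x ∈ p.support → x ∈ q.support → x ∈ T)

/-- The element-connectivity of `u` and `v` in `G` with terminal set `T`: the maximum number of
pairwise element-disjoint paths between `u` and `v`. -/
noncomputable def pairElementConnectivity {V : Type u} (G : SimpleGraph V) (T : Set V)
    (u v : V) : ℕ∞ :=
  sSup {N : ℕ∞ | ∃ (n : ℕ) (P : Fin n → G.Path u v), N = n ∧
    Pairwise fun i j => WalksElementDisjoint T (P i : G.Walk u v) (P j : G.Walk u v)}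

/-- The element-connectivity of the terminal set `T` in `G`: the minimum, over pairs of distinct
terminals, of the element-connectivity of the pair. -/
noncomputable def elementConnectivity {V : Type u} (G : SimpleGraph V) (T : Set V) : ℕ∞ :=
  ⨅ u ∈ T, ⨅ v ∈ T, ⨅ _ : u ≠ v, pairElementConnectivity G T u v

/-- A Steiner tree on `T`: a subgraph of `G` that is a tree and contains all of `T`. -/
def IsSteinerTree {V : Type u} {G : SimpleGraph V} (T : Set V) (H : G.Subgraph) : Prop :=
  H.coe.IsTree ∧ T ⊆ H.verts

/-- With respect to the set `T` of terminals, two subgraphs are element-disjoint if they have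
no edge and no non-terminal vertex in common. -/
def SubgraphsElementDisjoint {V : Type u} {G : SimpleGraph V} (T : Set V)
    (H K : G.Subgraph) : Prop :=
  Disjoint H.edgeSet K.edgeSet ∧ H.verts ∩ K.verts ⊆ T

end ElementPacking

/-! The argument turns the graph into a hypergraph on the terminals and packs connecting
sub-hypergraphs of it. The elements are the single nonterminals and the edges between terminals; by
element-connectivity every cut separating terminals costs at least `k` of them. Two adjacent blobs
can always be separated (their edges deleted) or merged without lowering a cut below `k`: otherwise
two cheap cuts would uncross to a contradiction (`IsElementFamily.delete_or_merge`). In the end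
distinct blobs are not adjacent, so each element is a hyperedge on its terminal ends, and every
bipartition of `T` is crossed by `k` hyperedges (`le_card_crossing`).

In a tree decomposition with bags of size at most `r`, terminals and hyperedges become subtrees of
low load. Double counting finds two terminals sharing many hyperedges whose tops lie in both
subtrees (`exists_heavy_pair`). Contracting that pair keeps every hypothesis, so the step repeats
until one vertex is left (`exists_merges`). A hyperedge used in a merge loses one of the at most `r`
subtrees through its top, so it is used at most `r` times. If each merge has `r * n` candidates,
Hall's theorem picks `n` disjoint systems of representatives (`exists_disjoint_transversals`); each
connects `T` and contains a Steiner tree. This gives order `k / r ^ 2` trees, without the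
logarithmic loss. -/

namespace ElementPacking

open Finset

/-! ### Subtrees of a rooted tree and their tops -/

section Walks

variable {V : Type*} {G : SimpleGraph V}

theorem preconnected_induce_iff_exists_walk {s : Set V} :
    (G.induce s).Preconnected ↔
      ∀ u ∈ s, ∀ v ∈ s, ∃ p : G.Walk u v, ∀ x ∈ p.support, x ∈ s := by
  constructor
  · intro h u hu v hv
    obtain ⟨p⟩ := h ⟨u, hu⟩ ⟨v, hv⟩
    let f : G.induce s →g G := (SimpleGraph.Embedding.induce s).toHom
    refine ⟨p.map f, fun x hx => ?_⟩
    have hx' : x ∈ p.support.map f := p.support_map f ▸ hx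
    obtain ⟨y, -, rfl⟩ := List.mem_map.1 hx'
    exact y.2
  · rintro h ⟨u, hu⟩ ⟨v, hv⟩
    obtain ⟨p, hp⟩ := h u hu v hv
    exact ⟨p.induce s hp⟩

/-- `x` is a point of `S` that is closest to `root`. -/
def IsTop (G : SimpleGraph V) (root : V) (S : Set V) (x : V) : Prop :=
  x ∈ S ∧ ∀ y ∈ S, G.dist x root ≤ G.dist y root

theorem exists_isTop (G : SimpleGraph V) (root : V) {S : Set V} (hS : S.Nonempty) :
    ∃ x, IsTop G root S x := by
  obtain ⟨x, hx, h⟩ := exists_minimalFor_of_wellFoundedLT (· ∈ S) (fun x => G.dist x root) hS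
  exact ⟨x, hx, fun y hy => (le_total _ _).elim id fun hle => h hy hle⟩

theorem dist_lt_of_mem_support {t root y : V} {q : G.Walk t root}
    (hq : q.length = G.dist t root) (hy : y ∈ q.support) (hne : y ≠ t) :
    G.dist y root < G.dist t root := by
  classical
  have h1 := SimpleGraph.dist_le (q.dropUntil y hy)
  have h2 : (q.takeUntil y hy).length + (q.dropUntil y hy).length = q.length := by
    rw [← SimpleGraph.Walk.length_append, SimpleGraph.Walk.take_spec]
  have h3 : (q.takeUntil y hy).length ≠ 0 := fun h0 =>
    hne (SimpleGraph.Walk.eq_of_length_eq_zero h0).symm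
  omega

/-- In a tree, every walk to the root from a connected set passes through its top. -/
theorem IsTop.mem_support (hG : G.IsTree) {root t x : V} {S : Set V}
    (hS : (G.induce S).Preconnected) (ht : IsTop G root S t) (hx : x ∈ S) (p : G.Walk x root) :
    t ∈ p.support := by
  classical
  obtain ⟨q, hqp, hq⟩ := hG.connected.exists_path_of_dist t root
  obtain ⟨w, hw⟩ := preconnected_induce_iff_exists_walk.1 hS x hx t ht.1
  -- After `t` the geodesic `q` is strictly closer to the root than any point of `S`, so it cannot
  -- meet `w` again. Uniqueness of paths in a tree then places `t` on `p`.
  have hpath : (w.bypass.append q).IsPath := by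
    rw [SimpleGraph.Walk.isPath_def, SimpleGraph.Walk.support_append, List.nodup_append']
    have hqn := hqp.support_nodup
    rw [← SimpleGraph.Walk.cons_tail_support, List.nodup_cons] at hqn
    refine ⟨w.bypass_isPath.support_nodup, hqn.2, ?_⟩
    intro y hy1 hy2
    have hyS := hw y (w.support_bypass_subset_support hy1)
    have hyt : y ≠ t := by
      rintro rfl
      exact hqn.1 hy2
    exact absurd (dist_lt_of_mem_support hq (List.mem_of_mem_tail hy2) hyt)
      (not_lt.2 (ht.2 y hyS))
  have heq : p.bypass = w.bypass.append q :=
    congrArg Subtype.val <| (hG.isAcyclic.subsingleton_path x root).elim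
      ⟨p.bypass, p.bypass_isPath⟩ ⟨_, hpath⟩
  apply p.support_bypass_subset_support
  rw [heq, SimpleGraph.Walk.mem_support_append_iff]
  exact Or.inr q.start_mem_support

/-- If `t₁` were outside `S₂`, a walk inside `S₂` from `x` to `t₂` would avoid it. So `t₁` would
separate `t₂` from the root just as it separates `x`, and would be strictly closer to the root than
`t₂`. -/
theorem IsTop.mem_of_dist_le (hG : G.IsTree) {root t₁ t₂ x : V} {S₁ S₂ : Set V}
    (h₁ : (G.induce S₁).Preconnected) (h₂ : (G.induce S₂).Preconnected)
    (ht₁ : IsTop G root S₁ t₁) (ht₂ : IsTop G root S₂ t₂) (hx₁ : x ∈ S₁) (hx₂ : x ∈ S₂)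
    (hle : G.dist t₂ root ≤ G.dist t₁ root) : t₁ ∈ S₂ := by
  by_contra hnot
  obtain ⟨w, hw⟩ := preconnected_induce_iff_exists_walk.1 h₂ x hx₂ t₂ ht₂.1
  have key : ∀ {a b : V} (w : G.Walk a b), (∀ y ∈ w.support, y ∈ S₂) →
      (∀ p : G.Walk a root, t₁ ∈ p.support) → ∀ p : G.Walk b root, t₁ ∈ p.support := by
    intro a b w
    induction w with
    | nil => exact fun _ h => h
    | @cons a b c hab w ih =>
      intro hw h
      refine ih (fun y hy => hw y (by simp [hy])) fun p => ?_
      have := h (SimpleGraph.Walk.cons hab p)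
      rw [SimpleGraph.Walk.support_cons, List.mem_cons] at this
      rcases this with rfl | h
      · exact absurd (hw _ (by simp)) hnot
      · exact h
  obtain ⟨q, -, hq⟩ := hG.connected.exists_path_of_dist t₂ root
  have hmem := key w hw (fun p => ht₁.mem_support hG h₁ hx₁ p) q
  have hne : t₁ ≠ t₂ := by
    rintro rfl
    exact hnot ht₂.1
  exact absurd (dist_lt_of_mem_support hq hmem hne) (not_lt.2 hle)

/-- Of two intersecting subtrees, one contains the top of the other. -/
theorem IsTop.mem_or_mem (hG : G.IsTree) {root t₁ t₂ : V} {S₁ S₂ : Set V}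
    (h₁ : (G.induce S₁).Preconnected) (h₂ : (G.induce S₂).Preconnected)
    (ht₁ : IsTop G root S₁ t₁) (ht₂ : IsTop G root S₂ t₂) (h : (S₁ ∩ S₂).Nonempty) :
    t₁ ∈ S₂ ∨ t₂ ∈ S₁ := by
  obtain ⟨x, hx₁, hx₂⟩ := h
  rcases le_total (G.dist t₂ root) (G.dist t₁ root) with hle | hle
  · exact Or.inl (ht₁.mem_of_dist_le hG h₁ h₂ ht₂ hx₁ hx₂ hle)
  · exact Or.inr (ht₂.mem_of_dist_le hG h₂ h₁ ht₁ hx₂ hx₁ hle)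

end Walks

/-! ### Contracting a hypergraph of subtrees, and Hall's theorem -/

section Merging

open Classical in
/-- Two terminals whose subtrees share the tops of many common hyperedges. -/
theorem exists_heavy_pair {Node ι τ : Type*} [Fintype ι] [Fintype τ]
    {G : SimpleGraph Node} (hG : G.IsTree) {root : Node}
    {Q : ι → Set Node} (hQ : ∀ i, (G.induce (Q i)).Preconnected)
    {top : ι → Node} (htop : ∀ i, IsTop G root (Q i) (top i))
    {r k L : ℕ} (hr : 0 < r) (hkL : 2 * r * L + 2 * r ≤ k)
    (hQload : ∀ x, #{i | x ∈ Q i ∧ x ≠ top i} ≤ r)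
    {S : τ → Set Node} (hS : ∀ t, (G.induce (S t)).Preconnected) (hSne : ∀ t, (S t).Nonempty)
    (hSload : ∀ x, #{t | x ∈ S t} ≤ r)
    {N : ι → Set τ} (hN : ∀ i, ∀ t ∈ N i, (S t ∩ Q i).Nonempty) [Nonempty τ]
    (hdeg : ∀ t, k ≤ #{i | t ∈ N i ∧ ∃ s ∈ N i, s ≠ t}) :
    ∃ a b, a ≠ b ∧ L ≤ #{i | a ∈ N i ∧ b ∈ N i ∧ top i ∈ S a ∧ top i ∈ S b} := by
  choose apex hapex using fun t => exists_isTop G root (hSne t)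
  by_contra! hcon
  set m := Fintype.card τ with hm
  have hmpos : 0 < m := Fintype.card_pos
  -- Incidences of hyperedges having another end are split by the top: outside the subtree of the
  -- terminal (`B`), in that subtree but in no other end's (`O`), or shared with another end (`D`).
  -- Only `D` can be large.
  set P : Finset (τ × ι) := {z | z.1 ∈ N z.2 ∧ ∃ s ∈ N z.2, s ≠ z.1} with hP
  set B : Finset (τ × ι) := {z | z.1 ∈ N z.2 ∧ top z.2 ∉ S z.1} with hB
  set O : Finset (τ × ι) := {z | z ∈ P ∧ top z.2 ∈ S z.1 ∧
    ∀ s ∈ N z.2, s ≠ z.1 → top z.2 ∉ S s} with hO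
  set D : Finset (τ × ι) := {z | z.1 ∈ N z.2 ∧ top z.2 ∈ S z.1 ∧
    ∃ s ∈ N z.2, s ≠ z.1 ∧ top z.2 ∈ S s} with hD
  set E : Finset (τ × τ) := {z | z.1 ≠ z.2 ∧ (S z.1 ∩ S z.2).Nonempty} with hE
  set Tr : Finset ((τ × τ) × ι) := {z | z.1.1 ≠ z.1.2 ∧ z.1.1 ∈ N z.2 ∧ z.1.2 ∈ N z.2 ∧
    top z.2 ∈ S z.1.1 ∧ top z.2 ∈ S z.1.2} with hTr
  have hPcard : m * k ≤ #P := by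
    rw [card_eq_sum_card_fiberwise (f := Prod.fst) (t := univ) (fun _ _ => by simp)]
    have : #(univ : Finset τ) • k ≤ ∑ t : τ, #{z ∈ P | z.1 = t} := by
      refine card_nsmul_le_sum _ _ _ fun t _ => (hdeg t).trans ?_
      refine card_le_card_of_injOn (fun i => (t, i)) ?_ ?_
      · intro i hi
        simpa [hP] using hi
      · intro i _ j _ hij
        simpa using hij
    simpa [hm] using this
  have hBcard : #B ≤ r * m := by
    refine card_le_mul_card_image_of_maps_to (f := Prod.fst) (t := univ)
      (fun _ _ => mem_univ _) r fun t _ => ?_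
    refine le_trans (card_le_card_of_injOn Prod.snd ?_ ?_) (hQload (apex t))
    · rintro ⟨s, i⟩ hi
      simp only [hB, coe_filter, mem_filter, mem_univ, true_and, Set.mem_ofPred_eq] at hi
      obtain ⟨⟨h1, h2⟩, rfl⟩ := hi
      -- As the top of `Q i` misses `S s`, the apex of `S s` is a non-top node of `Q i`; the load
      -- bound allows at most `r` such `i` for each `s`.
      have h3 := IsTop.mem_or_mem hG (hS s) (hQ i) (hapex s) (htop i) (hN i s h1)
      simp only [coe_filter, mem_univ, true_and, Set.mem_ofPred_eq]
      refine ⟨h3.resolve_right h2, fun h => h2 ?_⟩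
      rw [← h]
      exact (hapex s).1
    · rintro ⟨s, i⟩ hi ⟨s', i'⟩ hi' h
      simp only [coe_filter, Set.mem_ofPred_eq] at hi hi'
      exact Prod.ext (hi.2.trans hi'.2.symm) h
  -- Charge to any other end of the same hyperedge, which is in `B`. Each hyperedge has at most one
  -- incidence in `O`, so the charging is injective.
  have hOcard : #O ≤ #B := by
    have hex : ∀ z : τ × ι, ∃ s, z ∈ O → s ∈ N z.2 ∧ s ≠ z.1 := by
      intro z
      by_cases hz : z ∈ O
      · simp only [hO, hP, mem_filter, mem_univ, true_and] at hz
        obtain ⟨s, hs, hs'⟩ := hz.1.2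
        exact ⟨s, fun _ => ⟨hs, hs'⟩⟩
      · exact ⟨z.1, fun h => absurd h hz⟩
    choose f hf using hex
    refine card_le_card_of_injOn (fun z => (f z, z.2)) ?_ ?_
    · intro z hz
      have hz' := hf z hz
      simp only [hO, coe_filter, mem_univ, true_and, Set.mem_ofPred_eq] at hz
      simp only [hB, coe_filter, mem_univ, true_and, Set.mem_ofPred_eq]
      exact ⟨hz'.1, hz.2.2 _ hz'.1 hz'.2⟩
    · rintro ⟨s, i⟩ hz ⟨s', i'⟩ hz' h
      obtain rfl : i = i' := congrArg Prod.snd h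
      simp only [hO, hP, mem_filter, coe_filter, mem_univ, true_and, Set.mem_ofPred_eq] at hz hz'
      by_contra hne
      refine hz.2.2 s' hz'.1.1 (fun h => hne (by rw [h])) hz'.2.1
  have hPsub : #P ≤ #B + #O + #D := by
    refine (card_le_card (t := B ∪ O ∪ D) ?_).trans
      ((card_union_le _ _).trans (by gcongr; exact card_union_le _ _))
    intro z hz
    have hz0 := hz
    simp only [hP, mem_filter, mem_univ, true_and] at hz
    simp only [hB, hO, hD, mem_union, mem_filter, mem_univ, true_and]
    by_cases h1 : top z.2 ∈ S z.1
    · by_cases h2 : ∃ s ∈ N z.2, s ≠ z.1 ∧ top z.2 ∈ S s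
      · exact Or.inr ⟨hz.1, h1, h2⟩
      · push Not at h2
        exact Or.inl (Or.inr ⟨hz0, h1, h2⟩)
    · exact Or.inl (Or.inl ⟨hz.1, h1⟩)
  have hDcard : #D ≤ #Tr := by
    have hex : ∀ z : τ × ι, ∃ s, z ∈ D → s ∈ N z.2 ∧ s ≠ z.1 ∧ top z.2 ∈ S s := by
      intro z
      by_cases hz : z ∈ D
      · simp only [hD, mem_filter, mem_univ, true_and] at hz
        obtain ⟨s, hs⟩ := hz.2.2
        exact ⟨s, fun _ => hs⟩
      · exact ⟨z.1, fun h => absurd h hz⟩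
    choose f hf using hex
    refine card_le_card_of_injOn (fun z => ((z.1, f z), z.2)) ?_ ?_
    · intro z hz
      have hz' := hf z hz
      simp only [hD, coe_filter, mem_univ, true_and, Set.mem_ofPred_eq] at hz
      simp only [hTr, coe_filter, mem_univ, true_and, Set.mem_ofPred_eq]
      exact ⟨hz'.2.1.symm, hz.1, hz'.1, hz.2.1, hz'.2.2⟩
    · rintro ⟨s, i⟩ - ⟨s', i'⟩ - h
      simp only [Prod.mk.injEq] at h
      exact Prod.ext h.1.1 h.2
  -- Of two meeting subtrees one contains the other's apex, and each of the `m` apices lies in at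
  -- most `r` subtrees.
  have hEcard : #E ≤ r * m + r * m := by
    refine (card_le_card (t := ({z | apex z.1 ∈ S z.2} : Finset (τ × τ)) ∪
      ({z | apex z.2 ∈ S z.1} : Finset (τ × τ))) ?_).trans
      ((card_union_le _ _).trans (add_le_add ?_ ?_))
    · rintro ⟨a, b⟩ hz
      simp only [hE, mem_filter, mem_univ, true_and] at hz
      simpa using IsTop.mem_or_mem hG (hS a) (hS b) (hapex a) (hapex b) hz.2
    · refine card_le_mul_card_image_of_maps_to (f := Prod.fst) (t := univ)
        (fun _ _ => mem_univ _) r fun t _ => ?_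
      refine le_trans (card_le_card_of_injOn Prod.snd ?_ ?_) (hSload (apex t))
      · rintro ⟨a, b⟩ hz
        simp only [coe_filter, mem_filter, mem_univ, true_and, Set.mem_ofPred_eq] at hz
        obtain ⟨h, rfl⟩ := hz
        simpa using h
      · rintro ⟨a, b⟩ hz ⟨a', b'⟩ hz' h
        simp only [coe_filter, Set.mem_ofPred_eq] at hz hz'
        exact Prod.ext (hz.2.trans hz'.2.symm) h
    · refine card_le_mul_card_image_of_maps_to (f := Prod.snd) (t := univ)
        (fun _ _ => mem_univ _) r fun t _ => ?_
      refine le_trans (card_le_card_of_injOn Prod.fst ?_ ?_) (hSload (apex t))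
      · rintro ⟨a, b⟩ hz
        simp only [coe_filter, mem_filter, mem_univ, true_and, Set.mem_ofPred_eq] at hz
        obtain ⟨h, rfl⟩ := hz
        simpa using h
      · rintro ⟨a, b⟩ hz ⟨a', b'⟩ hz' h
        simp only [coe_filter, Set.mem_ofPred_eq] at hz hz'
        exact Prod.ext h (hz.2.trans hz'.2.symm)
  have hTrcard : #Tr ≤ (L - 1) * #E := by
    refine card_le_mul_card_image_of_maps_to (f := Prod.fst) (t := E) ?_ (L - 1) ?_
    · rintro ⟨⟨a, b⟩, i⟩ hz
      simp only [hTr, mem_filter, mem_univ, true_and] at hz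
      simp only [hE, mem_filter, mem_univ, true_and]
      exact ⟨hz.1, top i, hz.2.2.2⟩
    · rintro ⟨a, b⟩ hab
      simp only [hE, mem_filter, mem_univ, true_and] at hab
      refine le_trans (card_le_card_of_injOn Prod.snd ?_ ?_) (Nat.le_sub_one_of_lt (hcon a b hab.1))
      · rintro ⟨⟨a', b'⟩, i⟩ hz
        simp only [hTr, coe_filter, mem_filter, mem_univ, true_and, Set.mem_ofPred_eq,
          Prod.mk.injEq] at hz
        obtain ⟨h, rfl, rfl⟩ := hz
        simpa using h.2
      · rintro ⟨z, i⟩ hz ⟨z', i'⟩ hz' h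
        simp only [coe_filter, Set.mem_ofPred_eq] at hz hz'
        exact Prod.ext (hz.2.trans hz'.2.symm) h
  have h1 : m * k ≤ m * (2 * r + (L - 1) * (2 * r)) :=
    calc m * k ≤ r * m + r * m + (L - 1) * (r * m + r * m) := by
          have := Nat.mul_le_mul_left (L - 1) hEcard
          omega
      _ = _ := by ring
  have h2 : k ≤ 2 * r + (L - 1) * (2 * r) := Nat.le_of_mul_le_mul_left h1 hmpos
  -- For `L = 0` the subtraction `L - 1` truncates, but then any two distinct terminals contradict
  -- `hcon`.
  rcases L with _ | L
  · obtain ⟨t⟩ := ‹Nonempty τ›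
    have hk0 : 0 < k := by omega
    obtain ⟨i, hi⟩ := card_pos.1 (hk0.trans_le (hdeg t))
    simp only [mem_filter, mem_univ, true_and] at hi
    obtain ⟨h, s, -, hs⟩ := hi
    exact absurd (hcon s t hs) (Nat.not_lt_zero _)
  · simp only [Nat.add_sub_cancel] at h2
    nlinarith

/-- The hyperedges `N i`, `i ∈ J`, connect the vertex set `τ`. -/
def CutConnected {ι τ : Type*} (N : ι → Set τ) (J : Set ι) : Prop :=
  ∀ A : Set τ, A.Nonempty → Aᶜ.Nonempty → ∃ i ∈ J, (N i ∩ A).Nonempty ∧ (N i ∩ Aᶜ).Nonempty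

open Classical in
/-- A sequence of merges, each along many hyperedges, such that every hyperedge is used by at
most as many merges as there are terminals whose subtree contains its top. -/
theorem exists_merges {Node : Type*} {ι : Type*} [Fintype ι]
    {G : SimpleGraph Node} (hG : G.IsTree) {root : Node}
    {Q : ι → Set Node} (hQ : ∀ i, (G.induce (Q i)).Preconnected)
    {top : ι → Node} (htop : ∀ i, IsTop G root (Q i) (top i))
    {r k L : ℕ} (hr : 0 < r) (hL : 0 < L) (hkL : 2 * r * L + 2 * r ≤ k)
    (hQload : ∀ x, #{i | x ∈ Q i ∧ x ≠ top i} ≤ r) (m : ℕ) :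
    ∀ (τ : Type*) [Fintype τ] (_ : Fintype.card τ = m + 1)
    (S : τ → Set Node) (_ : ∀ t, (G.induce (S t)).Preconnected) (_ : ∀ t, (S t).Nonempty)
    (_ : ∀ x, #{t | x ∈ S t} ≤ r)
    (N : ι → Set τ) (_ : ∀ i, ∀ t ∈ N i, (S t ∩ Q i).Nonempty)
    (_ : ∀ A : Set τ, A.Nonempty → Aᶜ.Nonempty →
      k ≤ #{i | (N i ∩ A).Nonempty ∧ (N i ∩ Aᶜ).Nonempty}),
    ∃ W : Fin m → Finset ι, (∀ j, L ≤ #(W j)) ∧ (∀ i, #{j | i ∈ W j} ≤ #{t | top i ∈ S t}) ∧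
      ∀ J : Set ι, (∀ j, ∃ i ∈ J, i ∈ W j) → CutConnected N J := by
  induction m with
  | zero =>
    intro τ _ hcard S hS hSne hSload N hN hcut
    have : Subsingleton τ := Fintype.card_le_one_iff_subsingleton.1 hcard.le
    refine ⟨Fin.elim0, fun j => j.elim0, fun i => by simp, fun J _ A ⟨a, ha⟩ ⟨b, hb⟩ => ?_⟩
    exact absurd (Subsingleton.elim a b ▸ ha) hb
  | succ m ih =>
    intro τ _ hcard S hS hSne hSload N hN hcut
    have hnt : Nontrivial τ := Fintype.one_lt_card_iff_nontrivial.1 (by omega)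
    obtain ⟨a, b, hab, hW⟩ := exists_heavy_pair hG hQ htop hr hkL hQload hS hSne hSload hN
      (fun t => by
        obtain ⟨s, hs⟩ := exists_ne t
        refine (hcut {t} ⟨t, rfl⟩ ⟨s, hs⟩).trans (card_le_card fun i hi => ?_)
        simp only [mem_filter, mem_univ, true_and] at hi ⊢
        obtain ⟨⟨t', ht', rfl⟩, ⟨s, hs, hs'⟩⟩ := hi
        exact ⟨ht', s, hs, hs'⟩)
    set W₀ : Finset ι := {i | a ∈ N i ∧ b ∈ N i ∧ top i ∈ S a ∧ top i ∈ S b} with hW₀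
    obtain ⟨i₀, hi₀⟩ := card_pos.1 (hL.trans_le hW)
    simp only [hW₀, mem_filter, mem_univ, true_and] at hi₀
    -- Contract `b` into `a`. The new subtree `S a ∪ S b` is connected through the top of `i₀`,
    -- which is where `0 < L` is needed.
    let f : τ → {t : τ // t ≠ b} := fun t => if h : t = b then ⟨a, hab⟩ else ⟨t, h⟩
    have hfb : f b = ⟨a, hab⟩ := by simp [f]
    have hfne : ∀ t (h : t ≠ b), f t = ⟨t, h⟩ := fun t h => by simp [f, h]
    let S' : {t : τ // t ≠ b} → Set Node := fun y => {x | ∃ t, f t = y ∧ x ∈ S t}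
    let N' : ι → Set {t : τ // t ≠ b} := fun i => f '' N i
    have hS'a : S' ⟨a, hab⟩ = S a ∪ S b := by
      ext x
      constructor
      · rintro ⟨t, ht, hx⟩
        by_cases h : t = b
        · exact Or.inr (h ▸ hx)
        · rw [hfne t h] at ht
          obtain rfl : t = a := congrArg Subtype.val ht
          exact Or.inl hx
      · rintro (hx | hx)
        · exact ⟨a, hfne a hab, hx⟩
        · exact ⟨b, hfb, hx⟩
    have hS'ne : ∀ t (h : t ≠ b), t ≠ a → S' ⟨t, h⟩ = S t := by
      intro t h hta
      ext x
      constructor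
      · rintro ⟨s, hs, hx⟩
        by_cases hsb : s = b
        · subst hsb
          rw [hfb] at hs
          exact absurd (congrArg Subtype.val hs).symm hta
        · rw [hfne s hsb] at hs
          obtain rfl : s = t := congrArg Subtype.val hs
          exact hx
      · exact fun hx => ⟨t, hfne t h, hx⟩
    have hload' : ∀ x [DecidablePred fun y => x ∈ S' y],
        ({y | x ∈ S' y} : Finset {t : τ // t ≠ b}) = ({t | x ∈ S t} : Finset τ).image f := by
      intro x _
      ext y
      simp only [mem_filter, mem_univ, true_and, mem_image]
      exact ⟨fun ⟨t, h1, h2⟩ => ⟨t, h2, h1⟩, fun ⟨t, h1, h2⟩ => ⟨t, h2, h1⟩⟩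
    have hSload' : ∀ x, #{y | x ∈ S' y} ≤ r := fun x =>
      (congrArg card (hload' x)).trans_le (card_image_le.trans (hSload x))
    obtain ⟨W, hW1, hW2, hW3⟩ := ih {t : τ // t ≠ b} (by simp [hcard]) S'
      (by
        rintro ⟨t, ht⟩
        by_cases hta : t = a
        · subst hta
          rw [hS'a]
          exact (SimpleGraph.induce_union_connected (hS t) (hS b)
            ⟨top i₀, hi₀.2.2.1, hi₀.2.2.2⟩).preconnected
        · rw [hS'ne t ht hta]
          exact hS t)
      (by
        rintro ⟨t, ht⟩
        obtain ⟨x, hx⟩ := hSne t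
        exact ⟨x, t, hfne t ht, hx⟩)
      (fun x => by convert hSload' x)
      N'
      (by
        rintro i _ ⟨t, ht, rfl⟩
        obtain ⟨x, hx, hx'⟩ := hN i t ht
        exact ⟨x, ⟨t, rfl, hx⟩, hx'⟩)
      (by
        rintro A ⟨y, hy⟩ ⟨z, hz⟩
        refine (hcut (f ⁻¹' A) ⟨y, ?_⟩ ⟨z, ?_⟩).trans (card_le_card fun i hi => ?_)
        · simpa [hfne y.1 y.2] using hy
        · simpa [hfne z.1 z.2] using hz
        · simp only [mem_filter, mem_univ, true_and] at hi ⊢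
          obtain ⟨⟨s, hs, hs'⟩, ⟨t, ht, ht'⟩⟩ := hi
          exact ⟨⟨f s, ⟨s, hs, rfl⟩, hs'⟩, ⟨f t, ⟨t, ht, rfl⟩, ht'⟩⟩)
    refine ⟨Fin.cons W₀ W, ?_, ?_, ?_⟩
    · intro j
      refine Fin.cases ?_ (fun j => ?_) j
      · simpa using hW
      · simpa using hW1 j
    · intro i
      have hsum : #{j | i ∈ (Fin.cons W₀ W : Fin (m + 1) → Finset ι) j} =
          (if i ∈ W₀ then 1 else 0) + #{j | i ∈ W j} := by
        rw [Fin.card_filter_univ_succ]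
        simp only [Fin.cons_zero, Fin.cons_succ]
        split_ifs <;> omega
      rw [hsum]
      have h2 := hW2 i
      rw [hload'] at h2
      split_ifs with hi
      · simp only [hW₀, mem_filter, mem_univ, true_and] at hi
        -- A hyperedge of `W₀` has its top in both merged subtrees, so the contraction lowers its
        -- count by at least one, which pays for this use.
        have hlt : #(({t | top i ∈ S t} : Finset τ).image f) < #{t | top i ∈ S t} := by
          refine lt_of_le_of_ne card_image_le fun heq => hab ?_
          refine card_image_iff.1 heq ?_ ?_ ?_
          · simpa using hi.2.2.1
          · simpa using hi.2.2.2
          · rw [hfb, hfne a hab]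
        omega
      · have := card_image_le (s := ({t | top i ∈ S t} : Finset τ)) (f := f)
        omega
    · intro J hJ A hA hAc
      -- A cut that does not split the pair descends to the contracted hypergraph; one that does is
      -- crossed by the representative from `W₀`.
      by_cases hsep : a ∈ A ↔ b ∈ A
      · have hpre : f ⁻¹' {y | y.1 ∈ A} = A := by
          ext t
          by_cases htb : t = b
          · subst htb
            simpa [hfb] using hsep
          · simp [hfne t htb]
        have hJ' : ∀ j, ∃ i ∈ J, i ∈ W j := fun j => by simpa using hJ j.succ
        have hne : ∀ C : Set τ, C.Nonempty → (∀ t, t ∈ C ↔ (f t).1 ∈ C) →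
            ∃ y : {t : τ // t ≠ b}, y.1 ∈ C := fun C ⟨t, ht⟩ h => ⟨f t, (h t).1 ht⟩
        have hmem : ∀ t, (f t).1 ∈ A ↔ t ∈ A := fun t => Set.ext_iff.1 hpre t
        obtain ⟨y, hy⟩ := hne A hA fun t => (hmem t).symm
        obtain ⟨z, hz⟩ := hne Aᶜ hAc fun t => not_congr (hmem t).symm
        obtain ⟨i, hi, ⟨_, ⟨s, hs, rfl⟩, hs'⟩, ⟨_, ⟨t, ht, rfl⟩, ht'⟩⟩ :=
          hW3 J hJ' {y | y.1 ∈ A} ⟨y, hy⟩ ⟨z, hz⟩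
        exact ⟨i, hi, ⟨s, hs, (hmem s).1 hs'⟩, ⟨t, ht, fun h => ht' ((hmem t).2 h)⟩⟩
      · obtain ⟨i, hi, hiW⟩ := hJ 0
        simp only [Fin.cons_zero, hW₀, mem_filter, mem_univ, true_and] at hiW
        by_cases haA : a ∈ A
        · have hbA : b ∉ A := fun h => hsep ⟨fun _ => h, fun _ => haA⟩
          exact ⟨i, hi, ⟨a, hiW.1, haA⟩, ⟨b, hiW.2.1, hbA⟩⟩
        · have hbA : b ∈ A := by
            by_contra h
            exact hsep ⟨fun h' => absurd h' haA, fun h' => absurd h' h⟩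
          exact ⟨i, hi, ⟨b, hiW.2.1, hbA⟩, ⟨a, hiW.1, haA⟩⟩

open Classical in
/-- Hall's theorem with multiplicities: if every element lies in at most `r` of the sets `W j`,
each of size at least `r * n`, there are `n` disjoint systems of representatives. -/
theorem exists_disjoint_transversals {ι κ : Type*} [Fintype κ] (W : κ → Finset ι)
    {r n : ℕ} (hr : 0 < r) (hW : ∀ j, r * n ≤ #(W j)) (hload : ∀ i, #{j | i ∈ W j} ≤ r) :
    ∃ J : Fin n → Set ι, (∀ c j, ∃ i ∈ J c, i ∈ W j) ∧
      ∀ c d, c ≠ d → Disjoint (J c) (J d) := by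
  -- Hall's condition for `n` copies of every `W j`: incidences over the projection of `s` number at
  -- least `r * n` per index and at most `r` per element.
  have hall : ∀ s : Finset (κ × Fin n), #s ≤ #(s.biUnion fun z => W z.1) := by
    intro s
    have h1 : #s ≤ n * #(s.image Prod.fst) := by
      refine card_le_mul_card_image s n fun j _ => ?_
      refine (card_le_card_of_injOn (t := (univ : Finset (Fin n))) Prod.snd
        (fun _ _ => mem_coe.2 (mem_univ _)) ?_).trans (by simp)
      rintro ⟨s, i⟩ hz ⟨s', i'⟩ hz' h
      simp only [coe_filter, Set.mem_ofPred_eq] at hz hz'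
      exact Prod.ext (hz.2.trans hz'.2.symm) h
    have h2 : r * n * #(s.image Prod.fst) ≤ r * #(s.biUnion fun z => W z.1) := by
      have h3 : r * n * #(s.image Prod.fst) ≤ ∑ j ∈ s.image Prod.fst, #(W j) := by
        have := card_nsmul_le_sum (s.image Prod.fst) (fun j => #(W j)) (r * n) fun j _ => hW j
        simpa [mul_comm] using this
      refine h3.trans ?_
      rw [← card_sigma]
      refine card_le_mul_card_image_of_maps_to (f := fun z => z.2) ?_ r ?_
      · rintro ⟨j, i⟩ hz
        simp only [mem_sigma, mem_image] at hz
        obtain ⟨⟨z, hz, rfl⟩, hi⟩ := hz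
        exact mem_biUnion.2 ⟨z, hz, hi⟩
      · intro i _
        refine (card_le_card_of_injOn (fun z => z.1) ?_ ?_).trans (hload i)
        · rintro ⟨j, i'⟩ hz
          simp only [coe_filter, mem_sigma, Set.mem_ofPred_eq] at hz
          obtain ⟨⟨-, hi⟩, rfl⟩ := hz
          simpa using hi
        · rintro ⟨j, i'⟩ hz ⟨j', i''⟩ hz' h
          simp only [coe_filter, mem_sigma, Set.mem_ofPred_eq] at hz hz' h
          obtain rfl := h
          rw [hz.2, hz'.2]
    rw [mul_assoc] at h2
    exact h1.trans (Nat.le_of_mul_le_mul_left h2 hr)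
  obtain ⟨g, hg, hgW⟩ := (all_card_le_biUnion_card_iff_exists_injective _).1 hall
  refine ⟨fun c => {i | ∃ j, g (j, c) = i}, fun c j => ⟨g (j, c), ⟨j, rfl⟩, hgW (j, c)⟩, ?_⟩
  intro c d hcd
  rw [Set.disjoint_left]
  rintro _ ⟨j, rfl⟩ ⟨j', h⟩
  exact hcd (congrArg Prod.snd (hg h)).symm

end Merging

/-! ### Submodular cuts and the reduction by deleting or merging -/

section Elements

variable {V : Type*}

open Classical in
/-- The number of elements of `X` that are contained in neither side of the cut. -/
noncomputable def cutCost (X : Finset (Set V)) (A B : Set V) : ℕ :=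
  #{Z ∈ X | ¬ Z ⊆ A ∧ ¬ Z ⊆ B}

theorem cutCost_comm (X : Finset (Set V)) (A B : Set V) : cutCost X A B = cutCost X B A := by
  unfold cutCost
  congr 1
  ext Z
  simp only [mem_filter]
  tauto

/-- Submodularity, checked element by element: one contained in a side of one old cut is free in at
least one new cut, and one contained in a side of each old cut is free in both. -/
theorem cutCost_uncross (X : Finset (Set V)) (A B C D : Set V) :
    cutCost X (A ∩ C) (B ∪ D) + cutCost X (A ∪ C) (B ∩ D) ≤ cutCost X A B + cutCost X C D := by
  classical
  simp only [cutCost, card_filter, ← sum_add_distrib]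
  refine sum_le_sum fun Z _ => ?_
  have h1 : Z ⊆ A → Z ⊆ A ∪ C := fun h => h.trans Set.subset_union_left
  have h2 : Z ⊆ C → Z ⊆ A ∪ C := fun h => h.trans Set.subset_union_right
  have h3 : Z ⊆ B → Z ⊆ B ∪ D := fun h => h.trans Set.subset_union_left
  have h4 : Z ⊆ D → Z ⊆ B ∪ D := fun h => h.trans Set.subset_union_right
  simp only [Set.subset_inter_iff]
  by_cases hA : Z ⊆ A <;> by_cases hB : Z ⊆ B <;> by_cases hC : Z ⊆ C <;> by_cases hD : Z ⊆ D <;>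
    simp [hA, hB, hC, hD, h1, h2, h3, h4] <;> split_ifs <;> simp

/-- Every cut between terminals that is respected by the edges of `R` has cost at least `k`. -/
def CutCondition (X : Finset (Set V)) (R : SimpleGraph V) (T : Set V) (k : ℕ) : Prop :=
  ∀ A B : Set V, Disjoint A B → (∀ u ∈ A, ∀ v ∈ B, ¬ R.Adj u v) → T ⊆ A ∪ B →
    (A ∩ T).Nonempty → (B ∩ T).Nonempty → k ≤ cutCost X A B

/-- A connected, nonempty set of nonterminals. -/
def IsBlob (G : SimpleGraph V) (T Z : Set V) : Prop :=
  Z.Nonempty ∧ (G.induce Z).Preconnected ∧ Disjoint Z T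

/-- The two ends of an edge between terminals. -/
def IsTerminalEdge (G : SimpleGraph V) (T Z : Set V) : Prop :=
  ∃ a ∈ T, ∃ b ∈ T, G.Adj a b ∧ Z = {a, b}

/-- A family of pairwise disjoint blobs, together with edges between terminals. -/
structure IsElementFamily (G : SimpleGraph V) (T : Set V) (X : Finset (Set V)) : Prop where
  blob_or_edge : ∀ Z ∈ X, IsBlob G T Z ∨ IsTerminalEdge G T Z
  mem_of_mem_of_mem : ∀ Z ∈ X, ∀ Z' ∈ X, Z ≠ Z' → ∀ x ∈ Z, x ∈ Z' → x ∈ T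

theorem IsElementFamily.disjoint {G : SimpleGraph V} {T : Set V} {X : Finset (Set V)}
    (hX : IsElementFamily G T X) {P Z : Set V} (hP : P ∈ X) (hPT : IsBlob G T P)
    (hZ : Z ∈ X) (hne : Z ≠ P) : Disjoint Z P := by
  rw [Set.disjoint_left]
  exact fun x hxZ hxP => Set.disjoint_left.1 hPT.2.2 hxP
    (hX.mem_of_mem_of_mem Z hZ P hP hne x hxZ hxP)

/-- Uncrossing two cuts whose sides can be combined without creating crossing edges. -/
theorem CutCondition.two_mul_le {X : Finset (Set V)} {R : SimpleGraph V} {T : Set V} {k : ℕ}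
    (h : CutCondition X R T k) {A B C D : Set V} (hAB : Disjoint A B) (hCD : Disjoint C D)
    (hAC : ∀ u ∈ A, ∀ v ∈ B, R.Adj u v → u ∉ C ∪ D ∧ v ∉ C ∪ D)
    (hR : ∀ u ∈ C, ∀ v ∈ D, ¬ R.Adj u v) (hT : T ⊆ A ∪ B) (hT' : T ⊆ C ∪ D)
    (h₁ : (A ∩ C ∩ T).Nonempty) (h₂ : (B ∩ D ∩ T).Nonempty) :
    2 * k ≤ cutCost X A B + cutCost X C D := by
  refine le_trans ?_ (cutCost_uncross X A B C D)
  obtain ⟨x, ⟨hxA, hxC⟩, hxT⟩ := h₁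
  obtain ⟨y, ⟨hyB, hyD⟩, hyT⟩ := h₂
  rw [Set.disjoint_left] at hAB hCD
  have e1 : k ≤ cutCost X (A ∩ C) (B ∪ D) := by
    refine h _ _ ?_ ?_ ?_ ⟨x, ⟨hxA, hxC⟩, hxT⟩ ⟨y, Or.inl hyB, hyT⟩
    · rw [Set.disjoint_left]
      rintro z ⟨hz1, hz2⟩ (hz | hz)
      · exact hAB hz1 hz
      · exact hCD hz2 hz
    · rintro u ⟨hu1, hu2⟩ v (hv | hv) huv
      · exact (hAC u hu1 v hv huv).1 (Or.inl hu2)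
      · exact hR u hu2 v hv huv
    · intro z hz
      rcases hT hz with h1 | h1
      · rcases hT' hz with h2 | h2
        · exact Or.inl ⟨h1, h2⟩
        · exact Or.inr (Or.inr h2)
      · exact Or.inr (Or.inl h1)
  have e2 : k ≤ cutCost X (A ∪ C) (B ∩ D) := by
    refine h _ _ ?_ ?_ ?_ ⟨x, Or.inl hxA, hxT⟩ ⟨y, ⟨hyB, hyD⟩, hyT⟩
    · rw [Set.disjoint_left]
      rintro z (hz | hz) ⟨hz1, hz2⟩
      · exact hAB hz hz1
      · exact hCD hz hz2
    · rintro u (hu | hu) v ⟨hv1, hv2⟩ huv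
      · exact (hAC u hu v hv1 huv).2 (Or.inr hv2)
      · exact hR u hu v hv2 huv
    · intro z hz
      rcases hT hz with h1 | h1
      · exact Or.inl (Or.inl h1)
      · rcases hT' hz with h2 | h2
        · exact Or.inl (Or.inr h2)
        · exact Or.inr ⟨h1, h2⟩
  omega

/-- The edges joining `P` and `Q`. -/
def edgesBetween (P Q : Set V) : Set (Sym2 V) :=
  {e | ∃ x ∈ P, ∃ y ∈ Q, e = s(x, y)}

open Classical in
/-- The family obtained by merging the members `P` and `Q`. -/
noncomputable def mergeBlobs (X : Finset (Set V)) (P Q : Set V) : Finset (Set V) :=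
  insert (P ∪ Q) ((X.erase P).erase Q)

theorem mem_mergeBlobs {X : Finset (Set V)} {P Q Z : Set V} :
    Z ∈ mergeBlobs X P Q ↔ Z = P ∪ Q ∨ Z ≠ Q ∧ Z ≠ P ∧ Z ∈ X := by
  simp [mergeBlobs]

theorem IsElementFamily.mergeBlobs {G : SimpleGraph V} {T : Set V} {X : Finset (Set V)}
    (hX : IsElementFamily G T X) {P Q : Set V} (hP : P ∈ X) (hQ : Q ∈ X)
    (hPT : IsBlob G T P) (hQT : IsBlob G T Q) {p q : V} (hp : p ∈ P) (hq : q ∈ Q)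
    (hpq : G.Adj p q) : IsElementFamily G T (mergeBlobs X P Q) where
  blob_or_edge := by
    intro Z hZ
    rw [mem_mergeBlobs] at hZ
    rcases hZ with rfl | ⟨-, -, hZ⟩
    · exact Or.inl ⟨⟨p, Or.inl hp⟩, (SimpleGraph.connected_induce_union hPT.2.1 hQT.2.1 hp hq
        hpq).preconnected, Set.disjoint_union_left.2 ⟨hPT.2.2, hQT.2.2⟩⟩
    · exact hX.blob_or_edge Z hZ
  mem_of_mem_of_mem := by
    intro Z hZ Z' hZ' hne x hx hx'
    rw [mem_mergeBlobs] at hZ hZ'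
    rcases hZ with rfl | ⟨hZ1, hZ2, hZ⟩
    · rcases hZ' with rfl | ⟨hZ1', hZ2', hZ'⟩
      · exact absurd rfl hne
      · rcases hx with hx | hx
        · exact hX.mem_of_mem_of_mem _ hP _ hZ' hZ2'.symm x hx hx'
        · exact hX.mem_of_mem_of_mem _ hQ _ hZ' hZ1'.symm x hx hx'
    · rcases hZ' with rfl | ⟨hZ1', hZ2', hZ'⟩
      · rcases hx' with hx' | hx'
        · exact hX.mem_of_mem_of_mem _ hZ _ hP hZ2 x hx hx'
        · exact hX.mem_of_mem_of_mem _ hZ _ hQ hZ1 x hx hx'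
      · exact hX.mem_of_mem_of_mem _ hZ _ hZ' hne x hx hx'

/-- A cheap cut after merging `P` and `Q` gives an almost as cheap cut avoiding `P` and `Q`. -/
theorem IsElementFamily.cutCost_sdiff_le {G : SimpleGraph V} {T : Set V} {X : Finset (Set V)}
    (hX : IsElementFamily G T X) {P Q : Set V} (hP : P ∈ X) (hQ : Q ∈ X)
    (hPT : IsBlob G T P) (hQT : IsBlob G T Q) {A B : Set V} (hA : ¬ P ∪ Q ⊆ A)
    (hB : ¬ P ∪ Q ⊆ B) :
    cutCost X (A \ (P ∪ Q)) (B \ (P ∪ Q)) ≤ cutCost (ElementPacking.mergeBlobs X P Q) A B + 1 := by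
  classical
  unfold cutCost
  set Y : Finset (Set V) := {Z ∈ ElementPacking.mergeBlobs X P Q | ¬ Z ⊆ A ∧ ¬ Z ⊆ B} with hY
  have hmem : P ∪ Q ∈ Y := by
    simp only [hY, mem_filter, mem_mergeBlobs]
    exact ⟨Or.inl trivial, hA, hB⟩
  -- Other members are disjoint from `P ∪ Q` and notice no change. The already counted `P ∪ Q` is
  -- exchanged for `P` and `Q`, a net loss of one.
  have hsub : ({Z ∈ X | ¬ Z ⊆ A \ (P ∪ Q) ∧ ¬ Z ⊆ B \ (P ∪ Q)} : Finset (Set V)) ⊆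
      insert P (insert Q (Y.erase (P ∪ Q))) := by
    intro Z hZ
    simp only [mem_filter] at hZ
    obtain ⟨hZX, hZA, hZB⟩ := hZ
    simp only [mem_insert, mem_erase]
    by_cases hZP : Z = P
    · exact Or.inl hZP
    by_cases hZQ : Z = Q
    · exact Or.inr (Or.inl hZQ)
    have hd : Disjoint Z (P ∪ Q) := Set.disjoint_union_right.2
      ⟨hX.disjoint hP hPT hZX hZP, hX.disjoint hQ hQT hZX hZQ⟩
    refine Or.inr (Or.inr ⟨?_, ?_⟩)
    · rintro rfl
      obtain ⟨x, hx⟩ := hPT.1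
      exact Set.disjoint_left.1 hd (Or.inl hx) (Or.inl hx)
    · simp only [hY, mem_filter, mem_mergeBlobs]
      exact ⟨Or.inr ⟨hZQ, hZP, hZX⟩, fun h => hZA (Set.subset_sdiff.2 ⟨h, hd⟩),
        fun h => hZB (Set.subset_sdiff.2 ⟨h, hd⟩)⟩
  have h1 := card_le_card hsub
  have h2 := card_insert_le P (insert Q (Y.erase (P ∪ Q)))
  have h3 := card_insert_le Q (Y.erase (P ∪ Q))
  have h4 := card_erase_of_mem hmem
  have h5 := card_pos.2 ⟨_, hmem⟩
  omega

theorem cutCost_le_mergeBlobs {X : Finset (Set V)} {P Q A B : Set V} (h : P ∪ Q ⊆ A) :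
    cutCost X A B ≤ cutCost (mergeBlobs X P Q) A B := by
  classical
  refine card_le_card fun Z hZ => ?_
  simp only [mem_filter, mem_mergeBlobs] at hZ ⊢
  refine ⟨Or.inr ⟨?_, ?_, hZ.1⟩, hZ.2⟩
  · rintro rfl
    exact hZ.2.1 (Set.subset_union_right.trans h)
  · rintro rfl
    exact hZ.2.1 (Set.subset_union_left.trans h)

/-- The edges between two adjacent blobs can be deleted or the blobs can be merged
without violating the cut condition. -/
theorem IsElementFamily.delete_or_merge {G R : SimpleGraph V} {T : Set V} {X : Finset (Set V)}
    {k : ℕ} (hX : IsElementFamily G T X) (hcut : CutCondition X R T k) {P Q : Set V}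
    (hP : P ∈ X) (hQ : Q ∈ X) (hPT : IsBlob G T P) (hQT : IsBlob G T Q) :
    CutCondition X (R.deleteEdges (edgesBetween P Q)) T k ∨
      CutCondition (ElementPacking.mergeBlobs X P Q) R T k := by
  by_contra! hcon
  unfold CutCondition at hcon
  push Not at hcon
  obtain ⟨⟨A, B, hAB, hABR, hABT, hA, hB, hABk⟩, ⟨C, D, hCD, hCDR, hCDT, hC, hD, hCDk⟩⟩ := hcon
  -- If one side held the merged blob, the cut would be equally cheap before merging.
  have hnC : ¬ P ∪ Q ⊆ C := fun h => by
    have h1 := hcut C D hCD hCDR hCDT hC hD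
    have h2 := cutCost_le_mergeBlobs (X := X) (B := D) h
    omega
  have hnD : ¬ P ∪ Q ⊆ D := fun h => by
    have h1 := hcut C D hCD hCDR hCDT hC hD
    have h2 := cutCost_le_mergeBlobs (X := X) (B := C) h
    rw [cutCost_comm, cutCost_comm _ D] at h2
    omega
  have hcost := hX.cutCost_sdiff_le hP hQ hPT hQT hnC hnD
  have hPQT : Disjoint (P ∪ Q) T := Set.disjoint_union_left.2 ⟨hPT.2.2, hQT.2.2⟩
  have hTn : ∀ x ∈ T, x ∉ P ∪ Q := fun x hx hx' => Set.disjoint_left.1 hPQT hx' hx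
  set C' := C \ (P ∪ Q)
  set D' := D \ (P ∪ Q)
  have hCD' : Disjoint C' D' := hCD.mono Set.sdiff_subset Set.sdiff_subset
  have hCDR' : ∀ u ∈ C', ∀ v ∈ D', ¬ R.Adj u v := fun u hu v hv => hCDR u hu.1 v hv.1
  have hCDT' : T ⊆ C' ∪ D' := fun x hx =>
    (hCDT hx).imp (fun h => ⟨h, hTn x hx⟩) fun h => ⟨h, hTn x hx⟩
  have hno : ∀ x ∈ P ∪ Q, x ∉ C' ∪ D' := by
    rintro x hx (h | h)
    · exact h.2 hx
    · exact h.2 hx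
  -- The only edges of `R` crossing the first cut join `P` to `Q`, and both sets were removed from
  -- the second cut, so uncrossing stays legitimate in `R`.
  have hcross : ∀ u ∈ A, ∀ v ∈ B, R.Adj u v → u ∉ C' ∪ D' ∧ v ∉ C' ∪ D' := by
    intro u hu v hv huv
    have := hABR u hu v hv
    rw [SimpleGraph.deleteEdges_adj, not_and, not_not] at this
    obtain ⟨x, hx, y, hy, hxy⟩ := this huv
    rcases Sym2.eq_iff.1 hxy with ⟨rfl, rfl⟩ | ⟨rfl, rfl⟩
    · exact ⟨hno _ (Or.inl hx), hno _ (Or.inr hy)⟩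
    · exact ⟨hno _ (Or.inr hy), hno _ (Or.inl hx)⟩
  -- The costs are at most `k - 1` and `k`, so a pair of opposite corners both containing terminals
  -- contradicts the bound `2 * k`. The remaining case analysis shows that such a pair exists.
  by_cases hd : (A ∩ C' ∩ T).Nonempty ∧ (B ∩ D' ∩ T).Nonempty
  · have := hcut.two_mul_le hAB hCD' hcross hCDR' hABT hCDT' hd.1 hd.2
    omega
  by_cases hd' : (A ∩ D' ∩ T).Nonempty ∧ (B ∩ C' ∩ T).Nonempty
  · have := hcut.two_mul_le hAB hCD'.symm (by rwa [Set.union_comm])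
      (fun u hu v hv h => hCDR' v hv u hu h.symm) hABT (by rwa [Set.union_comm]) hd'.1 hd'.2
    rw [cutCost_comm X D'] at this
    omega
  obtain ⟨a, haA, haT⟩ := hA
  obtain ⟨b, hbB, hbT⟩ := hB
  obtain ⟨c, hcC, hcT⟩ := hC
  obtain ⟨d, hdD, hdT⟩ := hD
  have hcC' : c ∈ C' := ⟨hcC, hTn c hcT⟩
  have hdD' : d ∈ D' := ⟨hdD, hTn d hdT⟩
  have q1 : ∀ x ∈ A, ∀ y ∈ B, x ∈ C' → y ∈ D' → x ∈ T → y ∈ T → False :=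
    fun x hx y hy hxC hyD hxT hyT => hd ⟨⟨x, ⟨hx, hxC⟩, hxT⟩, ⟨y, ⟨hy, hyD⟩, hyT⟩⟩
  have q2 : ∀ x ∈ A, ∀ y ∈ B, x ∈ D' → y ∈ C' → x ∈ T → y ∈ T → False :=
    fun x hx y hy hxD hyC hxT hyT => hd' ⟨⟨x, ⟨hx, hxD⟩, hxT⟩, ⟨y, ⟨hy, hyC⟩, hyT⟩⟩
  rcases hCDT' haT with ha | ha <;> rcases hCDT' hbT with hb | hb <;>
    rcases hABT hcT with hc | hc <;> rcases hABT hdT with hd0 | hd0 <;>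
    first
    | exact q1 a haA b hbB ha hb haT hbT
    | exact q2 a haA b hbB ha hb haT hbT
    | exact q1 a haA d hd0 ha hdD' haT hdT
    | exact q2 a haA c hc ha hcC' haT hcT
    | exact q1 c hc b hbB hcC' hb hcT hbT
    | exact q2 d hd0 b hbB hdD' hb hdT hbT
   
/-- Every element family can be reduced to one in which distinct blobs are not adjacent. -/
theorem IsElementFamily.exists_reduced [Finite V] {G : SimpleGraph V} {T : Set V} {k : ℕ}
    (n : ℕ) : ∀ (X : Finset (Set V)) (R : SimpleGraph V), #X + R.edgeSet.ncard = n → R ≤ G →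
    IsElementFamily G T X → CutCondition X R T k →
    ∃ (X' : Finset (Set V)) (R' : SimpleGraph V), R' ≤ R ∧ IsElementFamily G T X' ∧
      CutCondition X' R' T k ∧ ∀ P ∈ X', ∀ Q ∈ X', IsBlob G T P → IsBlob G T Q → P ≠ Q →
        ∀ p ∈ P, ∀ q ∈ Q, ¬ R'.Adj p q := by
  induction n using Nat.strong_induction_on with
  | _ n ih =>
    -- Deleting lowers the number of edges and merging the number of members. Blobs are connected in
    -- `G` rather than in `R`, so deletions never destroy them.
    intro X R hn hRG hX hcut
    by_cases hred : ∀ P ∈ X, ∀ Q ∈ X, IsBlob G T P → IsBlob G T Q → P ≠ Q →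
        ∀ p ∈ P, ∀ q ∈ Q, ¬ R.Adj p q
    · exact ⟨X, R, le_rfl, hX, hcut, hred⟩
    · push Not at hred
      obtain ⟨P, hP, Q, hQ, hPT, hQT, hPQ, p, hp, q, hq, hpq⟩ := hred
      rcases hX.delete_or_merge hcut hP hQ hPT hQT with h | h
      · have hlt : (R.deleteEdges (edgesBetween P Q)).edgeSet.ncard < R.edgeSet.ncard := by
          refine Set.ncard_lt_ncard ?_ (Set.toFinite _)
          refine SimpleGraph.edgeSet_ssubset_edgeSet.2
            (lt_of_le_of_ne (SimpleGraph.deleteEdges_le _) fun heq => ?_)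
          have : (R.deleteEdges (edgesBetween P Q)).Adj p q := by rwa [heq]
          rw [SimpleGraph.deleteEdges_adj] at this
          exact this.2 ⟨p, hp, q, hq, rfl⟩
        obtain ⟨X', R', h1, h2⟩ := ih _ (by omega) X (R.deleteEdges (edgesBetween P Q)) rfl
          ((SimpleGraph.deleteEdges_le _).trans hRG) hX h
        exact ⟨X', R', h1.trans (SimpleGraph.deleteEdges_le _), h2⟩
      · have hlt : #(ElementPacking.mergeBlobs X P Q) < #X := by
          classical
          have h1 : #(ElementPacking.mergeBlobs X P Q) ≤ #((X.erase P).erase Q) + 1 := by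
            unfold ElementPacking.mergeBlobs
            convert card_insert_le _ _
          have h2 := card_erase_of_mem hP
          have h3 := card_erase_of_mem (mem_erase.2 ⟨hPQ.symm, hQ⟩)
          have h4 : 0 < #(X.erase P) := card_pos.2 ⟨Q, mem_erase.2 ⟨hPQ.symm, hQ⟩⟩
          omega
        exact ih _ (by omega) _ R rfl hRG (hX.mergeBlobs hP hQ hPT hQT hp hq (hRG hpq)) h

end Elements

/-! ### From element-connectivity to the cut condition -/

section Initial

variable {V : Type*}

theorem mk_mem_edgesBetween_self {T : Set V} {u v : V} :
    s(u, v) ∈ edgesBetween T T ↔ u ∈ T ∧ v ∈ T := by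
  constructor
  · rintro ⟨x, hx, y, hy, h⟩
    rcases Sym2.eq_iff.1 h with ⟨rfl, rfl⟩ | ⟨rfl, rfl⟩
    · exact ⟨hx, hy⟩
    · exact ⟨hy, hx⟩
  · rintro ⟨hu, hv⟩
    exact ⟨u, hu, v, hv, rfl⟩

/-- The elements of a graph: single nonterminals, and edges between terminals. -/
noncomputable def initialElements [Finite V] (G : SimpleGraph V) (T : Set V) :
    Finset (Set V) :=
  (Set.toFinite {Z : Set V | (∃ x, x ∉ T ∧ Z = {x}) ∨ IsTerminalEdge G T Z}).toFinset

theorem mem_initialElements [Finite V] {G : SimpleGraph V} {T Z : Set V} :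
    Z ∈ initialElements G T ↔ (∃ x, x ∉ T ∧ Z = {x}) ∨ IsTerminalEdge G T Z := by
  simp [initialElements]

theorem isElementFamily_initialElements [Finite V] (G : SimpleGraph V) (T : Set V) :
    IsElementFamily G T (initialElements G T) where
  blob_or_edge := by
    intro Z hZ
    rw [mem_initialElements] at hZ
    rcases hZ with ⟨x, hx, rfl⟩ | hZ
    · refine Or.inl ⟨⟨x, rfl⟩, ?_, Set.disjoint_singleton_left.2 hx⟩
      rw [preconnected_induce_iff_exists_walk]
      rintro u rfl v rfl
      exact ⟨SimpleGraph.Walk.nil, by simp⟩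
    · exact Or.inr hZ
  mem_of_mem_of_mem := by
    intro Z hZ Z' hZ' hne x hx hx'
    rw [mem_initialElements] at hZ hZ'
    rcases hZ with ⟨y, hy, rfl⟩ | ⟨a, ha, b, hb, -, rfl⟩
    · rcases hZ' with ⟨y', hy', rfl⟩ | ⟨a, ha, b, hb, -, rfl⟩
      · obtain rfl : x = y := hx
        obtain rfl : x = y' := hx'
        exact absurd rfl hne
      · rcases hx' with rfl | rfl
        · exact ha
        · exact hb
    · rcases hx with rfl | rfl
      · exact ha
      · exact hb

/-- A walk from one side of a cut to the other passes through an element of the cut. -/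
theorem exists_element_of_walk [Finite V] {G : SimpleGraph V} {T A B : Set V}
    (hAB : Disjoint A B)
    (hR : ∀ u ∈ A, ∀ v ∈ B, ¬ (G.deleteEdges (edgesBetween T T)).Adj u v)
    (hT : T ⊆ A ∪ B) {u v : V} (hu : u ∈ A) (hv : v ∈ B) (p : G.Walk u v) :
    ∃ Z ∈ initialElements G T, (¬ Z ⊆ A ∧ ¬ Z ⊆ B) ∧
      ((∃ x, x ∉ T ∧ Z = {x} ∧ x ∈ p.support) ∨
        ∃ a ∈ T, ∃ b ∈ T, Z = {a, b} ∧ s(a, b) ∈ p.edges) := by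
  rw [Set.disjoint_left] at hAB
  obtain ⟨d, hd, hdA, hdA'⟩ := p.exists_boundary_dart A hu fun h => hAB h hv
  -- A step from `A` straight into `B` must use a deleted edge, hence a terminal edge; otherwise it
  -- enters an uncovered vertex, which is a nonterminal.
  by_cases hdB : d.snd ∈ B
  · have h := hR _ hdA _ hdB
    rw [SimpleGraph.deleteEdges_adj, not_and, not_not, mk_mem_edgesBetween_self] at h
    obtain ⟨h1, h2⟩ := h d.adj
    refine ⟨{d.fst, d.snd}, mem_initialElements.2 (Or.inr ⟨_, h1, _, h2, d.adj, rfl⟩),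
      ⟨fun h => hdA' (h (by simp)), fun h => hAB hdA (h (by simp))⟩,
      Or.inr ⟨_, h1, _, h2, rfl, ?_⟩⟩
    exact List.mem_map.2 ⟨d, hd, rfl⟩
  · have hdT : d.snd ∉ T := fun h => (hT h).elim hdA' hdB
    exact ⟨{d.snd}, mem_initialElements.2 (Or.inl ⟨_, hdT, rfl⟩),
      ⟨fun h => hdA' (h rfl), fun h => hdB (h rfl)⟩,
      Or.inl ⟨_, hdT, rfl, p.dart_snd_mem_support_of_mem_darts hd⟩⟩

/-- Element-connectivity `k` implies that all cuts have cost at least `k`. -/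
theorem cutCondition_initialElements [Finite V] {G : SimpleGraph V} {T : Set V} {k : ℕ}
    (h : (k : ℕ∞) ≤ elementConnectivity G T) :
    CutCondition (initialElements G T) (G.deleteEdges (edgesBetween T T)) T k := by
  classical
  rintro A B hAB hR hT ⟨u, huA, huT⟩ ⟨v, hvB, hvT⟩
  have huv : u ≠ v := by
    rintro rfl
    exact Set.disjoint_left.1 hAB huA hvB
  have hpair : (k : ℕ∞) ≤ pairElementConnectivity G T u v :=
    h.trans (iInf₂_le_of_le u huT (iInf₂_le_of_le v hvT (iInf_le _ huv)))
  rcases Nat.eq_zero_or_pos k with rfl | hk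
  · exact Nat.zero_le _
  -- A strict inequality below the supremum yields an actual path system, with more than `k - 1`
  -- paths.
  have hlt : ((k - 1 : ℕ) : ℕ∞) < pairElementConnectivity G T u v :=
    lt_of_lt_of_le (by exact_mod_cast Nat.sub_lt hk one_pos) hpair
  obtain ⟨_, ⟨n, P, rfl, hP⟩, hn⟩ := lt_sSup_iff.1 hlt
  have hkn : k - 1 < n := by exact_mod_cast hn
  choose Z hZ hZAB hZP using fun i =>
    exists_element_of_walk hAB hR hT huA hvB (P i : G.Walk u v)
  have hcard : #(univ : Finset (Fin n)) ≤ cutCost (initialElements G T) A B := by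
    refine card_le_card_of_injOn Z ?_ ?_
    · intro i _
      simp [hZ i, hZAB i]
    · intro i _ j _ hij
      by_contra hne
      have hdis := hP hne
      rcases hZP i with ⟨x, hxT, hx, hxp⟩ | ⟨a, ha, b, hb, hab, habp⟩
      · rcases hZP j with ⟨y, hyT, hy, hyp⟩ | ⟨c, hc, d, hd, hcd, hcdp⟩
        · rw [hx, hy, Set.singleton_eq_singleton_iff] at hij
          subst hij
          exact hxT (hdis.2 x hxp hyp)
        · have : c ∈ Z i := by rw [hij, hcd]; exact Or.inl rfl
          rw [hx] at this
          exact hxT (Set.mem_singleton_iff.1 this ▸ hc)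
      · rcases hZP j with ⟨y, hyT, hy, hyp⟩ | ⟨c, hc, d, hd, hcd, hcdp⟩
        · have : a ∈ Z j := by rw [← hij, hab]; exact Or.inl rfl
          rw [hy] at this
          exact hyT (Set.mem_singleton_iff.1 this ▸ ha)
        · rw [hab, hcd, Set.pair_eq_pair_iff] at hij
          have heq : s(a, b) = s(c, d) := Sym2.eq_iff.2 hij
          exact hdis.1 _ habp (heq ▸ hcdp)
  simp only [card_univ, Fintype.card_fin] at hcard
  omega

end Initial

/-! ### The hypergraph of a reduced family -/

section Hypergraph

variable {V : Type*}

/-- The terminals that lie in `Z` or are joined to `Z` by an edge of `R`. -/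
def elementEnds (R : SimpleGraph V) (T Z : Set V) : Set T :=
  {t | (t : V) ∈ Z ∨ ∃ z ∈ Z, R.Adj z t}

open Classical in
/-- In a reduced family, every bipartition of the terminals is crossed by `k` elements. -/
theorem le_card_crossing {G R : SimpleGraph V} {T : Set V} {X : Finset (Set V)} {k : ℕ}
    (hR : R ≤ G.deleteEdges (edgesBetween T T)) (hX : IsElementFamily G T X)
    (hcut : CutCondition X R T k)
    (hred : ∀ P ∈ X, ∀ Q ∈ X, IsBlob G T P → IsBlob G T Q → P ≠ Q →
      ∀ p ∈ P, ∀ q ∈ Q, ¬ R.Adj p q)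
    (A : Set T) (hA : A.Nonempty) (hA' : Aᶜ.Nonempty) :
    k ≤ #{Z ∈ X | (elementEnds R T Z ∩ A).Nonempty ∧ (elementEnds R T Z ∩ Aᶜ).Nonempty} := by
  have hRT : ∀ u v, R.Adj u v → u ∈ T → v ∉ T := fun u v huv hu hv => by
    have := hR huv
    rw [SimpleGraph.deleteEdges_adj, mk_mem_edgesBetween_self] at this
    exact this.2 ⟨hu, hv⟩
  set A' : Set V := {x | (∃ h : x ∈ T, ⟨x, h⟩ ∈ A) ∨
    ∃ Z ∈ X, IsBlob G T Z ∧ elementEnds R T Z ⊆ A ∧ x ∈ Z} with hAdef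
  -- Blobs with all ends on one side join that side. Blobs without ends satisfy both inclusions;
  -- demanding an end here assigns them to `A'` alone, which keeps the sides disjoint.
  set B' : Set V := {x | (∃ h : x ∈ T, ⟨x, h⟩ ∉ A) ∨
    ∃ Z ∈ X, IsBlob G T Z ∧ (elementEnds R T Z ⊆ Aᶜ ∧ (elementEnds R T Z).Nonempty) ∧ x ∈ Z}
    with hBdef
  have hblobT : ∀ Z, IsBlob G T Z → ∀ x ∈ Z, x ∉ T := fun Z hZ x hx hxT =>
    Set.disjoint_left.1 hZ.2.2 hx hxT
  have hsame : ∀ Z ∈ X, ∀ Z' ∈ X, IsBlob G T Z → ∀ x ∈ Z, x ∈ Z' → Z = Z' := by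
    intro Z hZ Z' hZ' hb x hx hx'
    by_contra hne
    exact hblobT Z hb x hx (hX.mem_of_mem_of_mem Z hZ Z' hZ' hne x hx hx')
  have hdisj : Disjoint A' B' := by
    rw [Set.disjoint_left]
    rintro x (⟨h, hxA⟩ | ⟨Z, hZ, hb, hZA, hx⟩) (⟨h', hxB⟩ | ⟨Z', hZ', hb', ⟨hZB, hne⟩, hx'⟩)
    · exact hxB hxA
    · exact hblobT _ hb' x hx' h
    · exact hblobT _ hb x hx h'
    · obtain rfl := hsame Z hZ Z' hZ' hb x hx hx'
      obtain ⟨t, ht⟩ := hne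
      exact hZB ht (hZA ht)
  have hno : ∀ u ∈ A', ∀ v ∈ B', ¬ R.Adj u v := by
    rintro x (⟨h, hxA⟩ | ⟨Z, hZ, hb, hZA, hx⟩) y (⟨h', hxB⟩ | ⟨Z', hZ', hb', ⟨hZB, hne⟩, hx'⟩) hxy
    · exact hRT x y hxy h h'
    · exact hZB (a := ⟨x, h⟩) (Or.inr ⟨y, hx', hxy.symm⟩) hxA
    · exact hxB (hZA (a := ⟨y, h'⟩) (Or.inr ⟨x, hx, hxy⟩))
    · by_cases hZZ : Z = Z'
      · subst hZZ
        obtain ⟨t, ht⟩ := hne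
        exact hZB ht (hZA ht)
      -- Reducedness is needed exactly here: an edge between distinct blobs could cross the cut.
      · exact hred Z hZ Z' hZ' hb hb' hZZ x hx y hx' hxy
  have hcov : T ⊆ A' ∪ B' := by
    intro x hx
    by_cases hxA : (⟨x, hx⟩ : T) ∈ A
    · exact Or.inl (Or.inl ⟨hx, hxA⟩)
    · exact Or.inr (Or.inl ⟨hx, hxA⟩)
  obtain ⟨a, ha⟩ := hA
  obtain ⟨b, hb⟩ := hA'
  refine (hcut A' B' hdisj hno hcov ⟨a, Or.inl ⟨a.2, ha⟩, a.2⟩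
    ⟨b, Or.inl ⟨b.2, hb⟩, b.2⟩).trans (card_le_card ?_)
  intro Z hZ
  simp only [mem_filter] at hZ ⊢
  obtain ⟨hZX, hZA, hZB⟩ := hZ
  refine ⟨hZX, ?_⟩
  rcases hX.blob_or_edge Z hZX with hbl | ⟨c, hc, d, hd, -, rfl⟩
  · have h1 : ¬ elementEnds R T Z ⊆ A := fun h => hZA fun x hx => Or.inr ⟨Z, hZX, hbl, h, hx⟩
    obtain ⟨t, ht, htA⟩ := Set.not_subset.1 h1
    have h2 : ¬ elementEnds R T Z ⊆ Aᶜ := fun h =>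
      hZB fun x hx => Or.inr ⟨Z, hZX, hbl, ⟨h, t, ht⟩, hx⟩
    obtain ⟨s, hs, hsA⟩ := Set.not_subset.1 h2
    exact ⟨⟨s, hs, not_not.1 hsA⟩, ⟨t, ht, htA⟩⟩
  · obtain ⟨x, hx, hxA⟩ := Set.not_subset.1 hZA
    obtain ⟨y, hy, hyB⟩ := Set.not_subset.1 hZB
    have hT : ∀ z ∈ ({c, d} : Set V), z ∈ T := by
      rintro z (rfl | rfl)
      · exact hc
      · exact hd
    refine ⟨⟨⟨y, hT y hy⟩, Or.inl hy, ?_⟩, ⟨⟨x, hT x hx⟩, Or.inl hx, ?_⟩⟩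
    · by_contra h
      exact hyB (Or.inl ⟨hT y hy, h⟩)
    · exact fun h => hxA (Or.inl ⟨hT x hx, h⟩)

end Hypergraph

/-! ### Steiner trees from connecting subfamilies -/

section Packing

variable {V : Type*}

/-- The edge `uv` has both ends in `Z`, or joins a nonterminal of `Z` to a terminal. -/
def Owns (T Z : Set V) (u v : V) : Prop :=
  (u ∈ Z ∧ v ∈ Z) ∨ (u ∈ Z ∧ u ∉ T ∧ v ∈ T) ∨ (v ∈ Z ∧ v ∉ T ∧ u ∈ T)

theorem Owns.symm {T Z : Set V} {u v : V} (h : Owns T Z u v) : Owns T Z v u := by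
  unfold Owns at *
  tauto

/-- The graph formed by the edges owned by members of `J`. -/
def ownedGraph (G : SimpleGraph V) (T : Set V) (J : Set (Set V)) : SimpleGraph V where
  Adj u v := G.Adj u v ∧ ∃ Z ∈ J, Owns T Z u v
  symm := ⟨fun _ _ ⟨h, Z, hZ, ho⟩ => ⟨h.symm, Z, hZ, ho.symm⟩⟩
  loopless := ⟨fun _ h => h.1.ne rfl⟩

theorem ownedGraph_le (G : SimpleGraph V) (T : Set V) (J : Set (Set V)) :
    ownedGraph G T J ≤ G := fun _ _ h => h.1

theorem reachable_ownedGraph_of_mem {G : SimpleGraph V} {T : Set V} {J : Set (Set V)} {Z : Set V}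
    (hZ : Z ∈ J) (hconn : (G.induce Z).Preconnected) {x y : V} (hx : x ∈ Z) (hy : y ∈ Z) :
    (ownedGraph G T J).Reachable x y := by
  let f : G.induce Z →g ownedGraph G T J :=
    ⟨Subtype.val, fun {a b} hab => ⟨hab, Z, hZ, Or.inl ⟨a.2, b.2⟩⟩⟩
  exact (hconn ⟨x, hx⟩ ⟨y, hy⟩).map f

theorem reachable_ownedGraph_of_mem_elementEnds {G R : SimpleGraph V} {T : Set V}
    {J : Set (Set V)} {Z : Set V} (hR : R ≤ G.deleteEdges (edgesBetween T T))
    (hZ : Z ∈ J) (hconn : (G.induce Z).Preconnected) {x : V} (hx : x ∈ Z) {t : T}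
    (ht : t ∈ elementEnds R T Z) : (ownedGraph G T J).Reachable x t := by
  rcases ht with ht | ⟨z, hz, hzt⟩
  · exact reachable_ownedGraph_of_mem hZ hconn hx ht
  · refine (reachable_ownedGraph_of_mem hZ hconn hx hz).trans (SimpleGraph.Adj.reachable ?_)
    have := hR hzt
    rw [SimpleGraph.deleteEdges_adj, mk_mem_edgesBetween_self] at this
    exact ⟨this.1, Z, hZ, Or.inr (Or.inl ⟨hz, fun h => this.2 ⟨h, t.2⟩, t.2⟩)⟩

theorem IsElementFamily.preconnected {G : SimpleGraph V} {T : Set V} {X : Finset (Set V)}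
    (hX : IsElementFamily G T X) {Z : Set V} (hZ : Z ∈ X) : (G.induce Z).Preconnected := by
  rcases hX.blob_or_edge Z hZ with h | ⟨a, -, b, -, hab, rfl⟩
  · exact h.2.1
  · exact (SimpleGraph.induce_pair_connected_of_adj hab).preconnected

theorem IsElementFamily.nonempty {G : SimpleGraph V} {T : Set V} {X : Finset (Set V)}
    (hX : IsElementFamily G T X) {Z : Set V} (hZ : Z ∈ X) : Z.Nonempty := by
  rcases hX.blob_or_edge Z hZ with h | ⟨a, -, b, -, hab, rfl⟩
  · exact h.1
  · exact ⟨a, Or.inl rfl⟩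

theorem IsElementFamily.reachable_of_cutConnected {G R : SimpleGraph V} {T : Set V}
    {X : Finset (Set V)} (hX : IsElementFamily G T X)
    (hR : R ≤ G.deleteEdges (edgesBetween T T)) {J : Set X}
    (hJ : CutConnected (fun Z : X => elementEnds R T Z) J) (s t : T) :
    (ownedGraph G T (Subtype.val '' J)).Reachable s t := by
  by_contra hst
  obtain ⟨Z, hZ, ⟨a, ha, haA⟩, ⟨b, hb, hbA⟩⟩ := hJ
    {x : T | (ownedGraph G T (Subtype.val '' J)).Reachable s x} ⟨s, SimpleGraph.Reachable.rfl⟩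
    ⟨t, hst⟩
  have hZJ : (Z : Set V) ∈ Subtype.val '' J := ⟨Z, hZ, rfl⟩
  have hc := hX.preconnected Z.2
  obtain ⟨x, hx⟩ := hX.nonempty Z.2
  exact hbA (haA.trans ((reachable_ownedGraph_of_mem_elementEnds hR hZJ hc hx ha).symm.trans
    (reachable_ownedGraph_of_mem_elementEnds hR hZJ hc hx hb)))

/-- A connected component containing all terminals contains a Steiner tree. -/
theorem exists_isSteinerTree [Finite V] {G H : SimpleGraph V} (hH : H ≤ G) {T : Set V} {t₀ : V}
    (hT : ∀ t ∈ T, H.Reachable t₀ t) :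
    ∃ F : G.Subgraph, IsSteinerTree T F ∧ (∀ x ∈ F.verts, H.Reachable t₀ x) ∧
      ∀ u v, F.Adj u v → H.Adj u v := by
  set C := H.connectedComponentMk t₀ with hC
  have hmem : ∀ x, x ∈ C ↔ H.Reachable t₀ x := fun x =>
    SimpleGraph.ConnectedComponent.eq.trans SimpleGraph.reachable_comm
  obtain ⟨K, hK, hKt⟩ := C.connected_toSimpleGraph.exists_isTree_le
  let F : G.Subgraph :=
    { verts := {x | x ∈ C}
      Adj := fun u v => ∃ (hu : u ∈ C) (hv : v ∈ C), K.Adj ⟨u, hu⟩ ⟨v, hv⟩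
      adj_sub := fun ⟨hu, hv, h⟩ => hH ((C.toSimpleGraph_adj hu hv).1 (hK h))
      edge_vert := fun ⟨hu, _, _⟩ => hu
      symm := ⟨fun _ _ ⟨hu, hv, h⟩ => ⟨hv, hu, h.symm⟩⟩ }
  have hcoe : F.coe = K := by
    ext u v
    exact ⟨fun ⟨_, _, h⟩ => h, fun h => ⟨u.2, v.2, h⟩⟩
  refine ⟨F, ⟨hcoe ▸ hKt, fun t ht => (hmem t).2 (hT t ht)⟩, fun x hx => (hmem x).1 hx, ?_⟩
  rintro u v ⟨hu, hv, h⟩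
  exact (C.toSimpleGraph_adj hu hv).1 (hK h)

/-- Disjoint connecting subfamilies yield element-disjoint Steiner trees. -/
theorem IsElementFamily.exists_packing [Finite V] {G R : SimpleGraph V} {T : Set V}
    (hTne : T.Nonempty) {X : Finset (Set V)} (hX : IsElementFamily G T X)
    (hR : R ≤ G.deleteEdges (edgesBetween T T)) {n : ℕ} {J : Fin n → Set X}
    (hJ : ∀ c, CutConnected (fun Z : X => elementEnds R T Z) (J c))
    (hdis : ∀ c d, c ≠ d → Disjoint (J c) (J d)) :
    ∃ F : Fin n → G.Subgraph, (∀ i, IsSteinerTree T (F i)) ∧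
      Pairwise fun i j => SubgraphsElementDisjoint T (F i) (F j) := by
  obtain ⟨t₀, ht₀⟩ := hTne
  choose F hF1 hF2 hF3 using fun c => exists_isSteinerTree
    (ownedGraph_le G T (Subtype.val '' J c)) (t₀ := t₀)
    fun t ht => hX.reachable_of_cutConnected hR (hJ c) ⟨t₀, ht₀⟩ ⟨t, ht⟩
  have hne : ∀ c d, c ≠ d → ∀ Z ∈ Subtype.val '' J c, ∀ Z' ∈ Subtype.val '' J d,
      Z ∈ X ∧ Z' ∈ X ∧ Z ≠ Z' := by
    rintro c d hcd _ ⟨Z, hZ, rfl⟩ _ ⟨Z', hZ', rfl⟩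
    refine ⟨Z.2, Z'.2, fun h => ?_⟩
    obtain rfl := Subtype.ext h
    exact Set.disjoint_left.1 (hdis c d hcd) hZ hZ'
  have hvert : ∀ c, ∀ x ∈ (F c).verts, x ∉ T → ∃ Z ∈ Subtype.val '' J c, x ∈ Z := by
    intro c x hx hxT
    -- A nonterminal of the tree differs from `t₀`, so it has an owned edge, whose owner must
    -- contain it.
    obtain ⟨p⟩ := (hF2 c x hx).symm
    cases p with
    | nil => exact absurd ht₀ hxT
    | cons h p =>
      obtain ⟨-, Z, hZ, ho⟩ := h
      refine ⟨Z, hZ, ?_⟩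
      rcases ho with ho | ho | ho
      · exact ho.1
      · exact ho.1
      · exact absurd ho.2.2 hxT
  refine ⟨F, hF1, fun c d hcd => ⟨?_, ?_⟩⟩
  · rw [Set.disjoint_left]
    intro e
    induction e with
    | _ u v =>
      intro hc hd
      rw [SimpleGraph.Subgraph.mem_edgeSet] at hc hd
      obtain ⟨huv, Z, hZ, ho⟩ := hF3 c u v hc
      obtain ⟨-, Z', hZ', ho'⟩ := hF3 d u v hd
      obtain ⟨hZX, hZX', hZZ⟩ := hne c d hcd Z hZ Z' hZ'
      have hcom := hX.mem_of_mem_of_mem Z hZX Z' hZX' hZZ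
      by_cases hu : u ∈ T
      · by_cases hv : v ∈ T
        -- An edge between terminals is owned only by its own end pair. Any other edge has a
        -- nonterminal end, which would lie in both owners.
        · have hpair : ∀ Y ∈ X, Owns T Y u v → Y = {u, v} := by
            intro Y hY hoY
            have huY : u ∈ Y ∧ v ∈ Y := by
              unfold Owns at hoY
              tauto
            rcases hX.blob_or_edge Y hY with hb | ⟨a, -, b, -, -, rfl⟩
            · exact absurd hu fun h => Set.disjoint_left.1 hb.2.2 huY.1 h
            · have hne := huv.ne
              obtain ⟨h1, h2⟩ := huY
              rcases h1 with rfl | rfl <;> rcases h2 with rfl | rfl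
              · exact absurd rfl hne
              · rfl
              · exact Set.pair_comm _ _
              · exact absurd rfl hne
          exact hZZ ((hpair Z hZX ho).trans (hpair Z' hZX' ho').symm)
        · have h1 := hcom v
          unfold Owns at ho ho'
          tauto
      · have h1 := hcom u
        unfold Owns at ho ho'
        tauto
  · rintro x ⟨hxc, hxd⟩
    by_contra hxT
    obtain ⟨Z, hZ, hxZ⟩ := hvert c x hxc hxT
    obtain ⟨Z', hZ', hxZ'⟩ := hvert d x hxd hxT
    obtain ⟨hZX, hZX', hZZ⟩ := hne c d hcd Z hZ Z' hZ'
    exact hxT (hX.mem_of_mem_of_mem Z hZX Z' hZX' hZZ x hxZ hxZ')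

end Packing

/-! ### Representing elements by subtrees of a tree decomposition -/

section TreeDecompositions

universe u

variable {V : Type u} {G : SimpleGraph V}

theorem exists_treeDecomposition_encard_le {r : ℕ} (hr : 1 ≤ r)
    (h : treewidth G ≤ ((r - 1 : ℕ) : ℕ∞)) :
    ∃ D : TreeDecomposition G, ∀ t, (D.bag t).encard ≤ r := by
  have hlt : treewidth G < (r : ℕ∞) :=
    h.trans_lt (by exact_mod_cast Nat.sub_lt hr one_pos)
  obtain ⟨D, hD⟩ := iInf_lt_iff.1 hlt
  refine ⟨D, fun t => (le_iSup (fun t => (D.bag t).encard) t).trans ?_⟩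
  have h1 : D.width + 1 ≤ (r : ℕ∞) := Order.add_one_le_of_lt hD
  exact le_tsub_add.trans h1

/-- The nodes whose bags meet a connected vertex set are connected. -/
theorem TreeDecomposition.preconnected_of_preconnected (D : TreeDecomposition G) {Z : Set V}
    (hZ : (G.induce Z).Preconnected) :
    (D.tree.induce {x | ∃ z ∈ Z, z ∈ D.bag x}).Preconnected := by
  rw [preconnected_induce_iff_exists_walk] at hZ ⊢
  have hone : ∀ z ∈ Z, ∀ x y, z ∈ D.bag x → z ∈ D.bag y →
      ∃ p : D.tree.Walk x y, ∀ w ∈ p.support, ∃ z ∈ Z, z ∈ D.bag w := by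
    intro z hz x y hx hy
    obtain ⟨p, hp⟩ := preconnected_induce_iff_exists_walk.1 (D.preconnected_nodes z) x hx y hy
    exact ⟨p, fun w hw => ⟨z, hz, hp w hw⟩⟩
  have key : ∀ {a b : V} (p : G.Walk a b), (∀ c ∈ p.support, c ∈ Z) → ∀ x y, a ∈ D.bag x →
      b ∈ D.bag y → ∃ q : D.tree.Walk x y, ∀ w ∈ q.support, ∃ z ∈ Z, z ∈ D.bag w := by
    intro a b p
    induction p with
    | nil => exact fun h x y hx hy => hone _ (h _ (by simp)) x y hx hy
    | @cons a b c hab p ih =>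
      intro h x y hx hy
      obtain ⟨w, hwa, hwb⟩ := D.exists_adj_mem_bag a b hab
      obtain ⟨q, hq⟩ := hone a (h _ (by simp)) x w hx hwa
      obtain ⟨q', hq'⟩ := ih (fun c hc => h c (by simp [hc])) w y hwb hy
      refine ⟨q.append q', fun v hv => ?_⟩
      rw [SimpleGraph.Walk.mem_support_append_iff] at hv
      exact hv.elim (hq v) (hq' v)
  rintro x ⟨a, ha, hax⟩ y ⟨b, hb, hby⟩
  obtain ⟨p, hp⟩ := hZ a ha b hb
  exact key p hp x y hax hby

/-- Every element is represented by a subtree that meets the subtrees of all its ends. -/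
theorem IsElementFamily.exists_subtree {R : SimpleGraph V} {T : Set V} {X : Finset (Set V)}
    (hX : IsElementFamily G T X) (hR : R ≤ G.deleteEdges (edgesBetween T T))
    (D : TreeDecomposition G) {Z : Set V} (hZ : Z ∈ X) :
    ∃ Q : Set D.Node, (D.tree.induce Q).Preconnected ∧ Q.Nonempty ∧
      (∀ t ∈ elementEnds R T Z, ({x | (t : V) ∈ D.bag x} ∩ Q).Nonempty) ∧
      (Q.Subsingleton ∨ ∀ x ∈ Q, ∃ z ∈ Z, z ∉ T ∧ z ∈ D.bag x) := by
  rcases hX.blob_or_edge Z hZ with hb | ⟨a, ha, b, hb, hab, rfl⟩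
  · have hZT : ∀ z ∈ Z, z ∉ T := fun z hz hzT => Set.disjoint_left.1 hb.2.2 hz hzT
    refine ⟨{x | ∃ z ∈ Z, z ∈ D.bag x}, D.preconnected_of_preconnected hb.2.1, ?_, ?_, Or.inr ?_⟩
    · obtain ⟨z, hz⟩ := hb.1
      obtain ⟨x, hx⟩ := D.exists_mem_bag z
      exact ⟨x, z, hz, hx⟩
    · rintro t (ht | ⟨z, hz, hzt⟩)
      · exact absurd t.2 (hZT _ ht)
      · obtain ⟨x, hx, hx'⟩ := D.exists_adj_mem_bag z t (SimpleGraph.deleteEdges_le _ (hR hzt))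
        exact ⟨x, hx', z, hz, hx⟩
    · rintro x ⟨z, hz, hx⟩
      exact ⟨z, hz, hZT z hz, hx⟩
  -- A terminal edge gets a single node. Many may share that node, but it is the top of each, and
  -- the load bound ignores tops.
  · obtain ⟨x, hxa, hxb⟩ := D.exists_adj_mem_bag a b hab
    refine ⟨{x}, ?_, ⟨x, rfl⟩, ?_, Or.inl Set.subsingleton_singleton⟩
    · rw [preconnected_induce_iff_exists_walk]
      rintro u rfl v rfl
      exact ⟨SimpleGraph.Walk.nil, by simp⟩
    · rintro t (ht | ⟨z, hz, hzt⟩)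
      · rcases ht with ht | ht
        · exact ⟨x, by simpa [ht] using hxa, rfl⟩
        · exact ⟨x, by simpa [Set.mem_singleton_iff.1 ht] using hxb, rfl⟩
      · have hzT : z ∈ T := by
          rcases hz with rfl | rfl
          · exact ha
          · exact hb
        have := hR hzt
        rw [SimpleGraph.deleteEdges_adj, mk_mem_edgesBetween_self] at this
        exact absurd ⟨hzT, t.2⟩ this.2

theorem card_le_of_injOn_encard {α β : Type*} {s : Finset α} {B : Set β} {r : ℕ}
    (hB : B.encard ≤ r) (f : α → β) (hf : ∀ a ∈ s, f a ∈ B) (hinj : Set.InjOn f s) :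
    #s ≤ r := by
  have h := (Set.encard_le_encard_of_injOn (s := (s : Set α)) (t := B) hf hinj).trans hB
  rw [Set.encard_coe_eq_coe_finsetCard] at h
  exact_mod_cast h

/-- A reduced element family of a graph of small treewidth contains many disjoint
connecting subfamilies. -/
theorem IsElementFamily.exists_connecting [Finite V] {R : SimpleGraph V} {T : Set V}
    {X : Finset (Set V)} (hX : IsElementFamily G T X)
    (hR : R ≤ G.deleteEdges (edgesBetween T T)) (hT : T.Nonempty) {k r n : ℕ} (hr : 1 ≤ r)
    (hn : 0 < n) (hkn : 2 * r * (r * n) + 2 * r ≤ k) (D : TreeDecomposition G)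
    (hD : ∀ t, (D.bag t).encard ≤ r) [Fintype T]
    (hcut : ∀ A : Set T, A.Nonempty → Aᶜ.Nonempty → ∃ Y : Finset X, k ≤ #Y ∧
      ∀ Z ∈ Y, (elementEnds R T Z ∩ A).Nonempty ∧ (elementEnds R T Z ∩ Aᶜ).Nonempty) :
    ∃ J : Fin n → Set X, (∀ c, CutConnected (fun Z : X => elementEnds R T Z) (J c)) ∧
      ∀ c d, c ≠ d → Disjoint (J c) (J d) := by
  classical
  choose Q hQ hQne hQN hQb using fun Z : X => hX.exists_subtree hR D Z.2
  obtain ⟨root⟩ := D.isTree.connected.nonempty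
  choose top htop using fun Z => exists_isTop D.tree root (hQne Z)
  have hTne : Nonempty T := hT.to_subtype
  obtain ⟨m, hm⟩ := Nat.exists_eq_succ_of_ne_zero (Fintype.card_ne_zero (α := T))
  have hSload : ∀ x, #{t : T | x ∈ {x | (t : V) ∈ D.bag x}} ≤ r := fun x =>
    card_le_of_injOn_encard (hD x) Subtype.val (fun t ht => by simpa using ht)
      Subtype.val_injective.injOn
  -- At a non-top node the subtree is not a singleton, so the element has a nonterminal in the bag
  -- of `x`; distinct elements give distinct ones.
  have hQload : ∀ x, #{Z : X | x ∈ Q Z ∧ x ≠ top Z} ≤ r := by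
    intro x
    have hex : ∀ Z : X, ∃ z, (x ∈ Q Z ∧ x ≠ top Z) → z ∈ (Z : Set V) ∧ z ∉ T ∧ z ∈ D.bag x := by
      intro Z
      by_cases hZ : x ∈ Q Z ∧ x ≠ top Z
      · rcases hQb Z with h | h
        · exact absurd (h hZ.1 (htop Z).1) hZ.2
        · obtain ⟨z, hz⟩ := h x hZ.1
          exact ⟨z, fun _ => hz⟩
      · obtain ⟨t, -⟩ := hT
        exact ⟨t, fun h => absurd h hZ⟩
    choose f hf using hex
    refine card_le_of_injOn_encard (hD x) f ?_ ?_
    · intro Z hZ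
      exact (hf Z (by simpa using hZ)).2.2
    · intro Z hZ Z' hZ' h
      have h1 := hf Z (by simpa using hZ)
      have h2 := hf Z' (by simpa using hZ')
      by_contra hne
      exact h1.2.1 (hX.mem_of_mem_of_mem Z Z.2 Z' Z'.2 (fun h => hne (Subtype.ext h)) _ h1.1
        (h ▸ h2.1))
  obtain ⟨W, hW1, hW2, hW3⟩ := exists_merges (L := r * n) D.isTree hQ htop hr
    (Nat.mul_pos hr hn) hkn hQload m T hm (fun t => {x | (t : V) ∈ D.bag x})
    (fun t => D.preconnected_nodes t) (fun t => D.exists_mem_bag t) hSload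
    (fun Z => elementEnds R T Z) hQN (fun A hA hA' => by
      obtain ⟨Y, hY, hYA⟩ := hcut A hA hA'
      exact hY.trans (card_le_card fun Z hZ => by simpa using hYA Z hZ))
  obtain ⟨J, hJ1, hJ2⟩ := exists_disjoint_transversals (n := n) W hr hW1
    fun i => (hW2 i).trans (hSload (top i))
  exact ⟨J, fun c => hW3 (J c) (hJ1 c), hJ2⟩

/-- The case `n = 1` covers `k` too small for the counting: as soon as `0 < k`, all elements
together cross every cut. -/
theorem exists_disjoint_steinerTrees [Finite V] {T : Set V} (hT : T.Nonempty)
    {r k n : ℕ} (hr : 1 ≤ r) (htw : treewidth G ≤ ((r - 1 : ℕ) : ℕ∞))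
    (hk : (k : ℕ∞) ≤ elementConnectivity G T)
    (hn : n = 1 ∧ 0 < k ∨ 0 < n ∧ 2 * r * (r * n) + 2 * r ≤ k) :
    ∃ F : Fin n → G.Subgraph, (∀ i, IsSteinerTree T (F i)) ∧
      Pairwise fun i j => SubgraphsElementDisjoint T (F i) (F j) := by
  classical
  have := Fintype.ofFinite T
  obtain ⟨X, R, hR, hX, hXcut, hred⟩ := IsElementFamily.exists_reduced _ _ _ rfl
    (SimpleGraph.deleteEdges_le _) (isElementFamily_initialElements G T)
    (cutCondition_initialElements hk)
  have hcut : ∀ A : Set T, A.Nonempty → Aᶜ.Nonempty → ∃ Y : Finset X, k ≤ #Y ∧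
      ∀ Z ∈ Y, (elementEnds R T Z ∩ A).Nonempty ∧ (elementEnds R T Z ∩ Aᶜ).Nonempty := by
    intro A hA hA'
    refine ⟨({Z : X | (elementEnds R T (Z : Set V) ∩ A).Nonempty ∧
      (elementEnds R T (Z : Set V) ∩ Aᶜ).Nonempty} : Finset X), ?_, fun Z hZ => by simpa using hZ⟩
    refine (le_card_crossing hR hX hXcut hred A hA hA').trans
      (card_le_card_of_surjOn Subtype.val ?_)
    intro Z hZ
    simp only [coe_filter, Set.mem_ofPred_eq] at hZ
    exact ⟨⟨Z, hZ.1⟩, by simpa using hZ.2, rfl⟩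
  rcases hn with ⟨rfl, hk0⟩ | ⟨hn, hkn⟩
  · refine hX.exists_packing hT hR (J := fun _ => Set.univ) (fun c A hA hA' => ?_) ?_
    · obtain ⟨Y, hY, hYA⟩ := hcut A hA hA'
      obtain ⟨Z, hZ⟩ := card_pos.1 (hk0.trans_le hY)
      exact ⟨Z, trivial, hYA Z hZ⟩
    · exact fun c d hcd => absurd (Subsingleton.elim c d) hcd
  · obtain ⟨D, hD⟩ := exists_treeDecomposition_encard_le hr htw
    obtain ⟨J, hJ, hdis⟩ := hX.exists_connecting hR hT hr hn hkn D hD hcut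
    exact hX.exists_packing hT hR hJ hdis

end TreeDecompositions

/-- Since `exp 1 < 3`, the logarithm is at least `1` and only weakens the bound, so `c = 1` works.
-/
theorem div_log_le {r k n : ℕ} (hr : 1 ≤ r) (h : k ≤ 12 * r ^ 2 * n) :
    (1 : ℝ) * ((k : ℝ) / (12 * (r : ℝ) ^ 2 * Real.log (3 * (r : ℝ)))) ≤ (n : ℝ) := by
  have hr' : (1 : ℝ) ≤ r := by exact_mod_cast hr
  have hlog : 1 ≤ Real.log (3 * (r : ℝ)) := by
    rw [Real.le_log_iff_exp_le (by positivity)]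
    have := Real.exp_one_lt_d9
    linarith
  have hk : (k : ℝ) ≤ 12 * (r : ℝ) ^ 2 * n := by exact_mod_cast h
  rw [one_mul, div_le_iff₀ (by positivity)]
  calc (k : ℝ) ≤ 12 * (r : ℝ) ^ 2 * n * 1 := by rwa [mul_one]
    _ ≤ 12 * (r : ℝ) ^ 2 * n * Real.log (3 * (r : ℝ)) := by gcongr
    _ = _ := by ring

end ElementPacking

theorem mainTheorem7 :
    ∃ c : ℝ, 0 < c ∧
      ∀ (V : Type*) [Finite V] (G : SimpleGraph V) (T : Set V), T.Nontrivial →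
      ∀ (r k : ℕ), 1 ≤ r →
        ElementPacking.treewidth G ≤ ((r - 1 : ℕ) : ℕ∞) →
        (k : ℕ∞) ≤ ElementPacking.elementConnectivity G T →
        ∃ (n : ℕ) (F : Fin n → G.Subgraph),
          c * ((k : ℝ) / (12 * (r : ℝ) ^ 2 * Real.log (3 * (r : ℝ)))) ≤ (n : ℝ) ∧
          (∀ i, ElementPacking.IsSteinerTree T (F i)) ∧
          Pairwise fun i j => ElementPacking.SubgraphsElementDisjoint T (F i) (F j) := by
  refine ⟨1, one_pos, fun V _ G T hT r k hr htw hk => ?_⟩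
  rcases Nat.eq_zero_or_pos k with rfl | hk0
  · exact ⟨0, Fin.elim0, by simp, fun i => i.elim0, fun i => i.elim0⟩
  have hpos : 0 < 12 * r ^ 2 := by positivity
  -- The `+ 1` rounds up. It is affordable when `12 * r ^ 2 ≤ k`, since `2 * r ^ 2 * n + 2 * r ≤ k /
  -- 6 + 4 * r ^ 2 ≤ k / 2`.
  obtain ⟨F, hF⟩ := ElementPacking.exists_disjoint_steinerTrees (n := k / (12 * r ^ 2) + 1)
    hT.nonempty hr htw hk (by
      rcases Nat.lt_or_ge k (12 * r ^ 2) with hlt | hge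
      · exact Or.inl ⟨by rw [Nat.div_eq_of_lt hlt], hk0⟩
      · refine Or.inr ⟨Nat.succ_pos _, ?_⟩
        have h1 := Nat.mul_div_le k (12 * r ^ 2)
        have h2 : r ≤ r ^ 2 := Nat.le_self_pow two_ne_zero r
        nlinarith)
  exact ⟨_, F, ElementPacking.div_log_le hr (Nat.lt_mul_div_succ k hpos).le, hF⟩
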